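/- Let $V$ be a finite-dimensional real inner product space and let $\Phi\subset V$ be an integral root system, i.e. a finite set with (i) $\Phi=-\Phi$; (ii) if $\alpha,k\alpha\in\Phi$ with $k\in\mathbb{R}$ then $k=\pm1$; (iii) $s_\alpha\Phi=\Phi$ for all $\alpha\in\Phi$, where $s_\alpha(x)=x-2\frac{\langle x,\alpha\rangle}{\langle\alpha,\alpha\rangle}\alpha$; (iv) $2\frac{\langle\alpha,\beta\rangle}{\langle\alpha,\alpha\rangle}\in\mathbb{Z}$ for all $\alpha,\beta\in\Phi$. Let $W$ be its Weyl group (generated by the $s_\alpha$, $\alpha\in\Phi$), $\{\alpha_1,\dots,\alpha_r\}$ a system of simple roots, $P$ the corresponding set of positive roots, $\rho=\frac12\sum_{\alpha\in P}\alpha$, and $\Lambda=\mathbb{Z}w_1+\cdots+\mathbb{Z}w_r$ the weight lattice, where $w_1,\dots,w_r$ is the basis of $\mathrm{span}_{\mathbb{R}}\Phi$ dual to $\frac{2\alpha_1}{\langle\alpha_1,\alpha_1\rangle},\dots,\frac{2\alpha_r}{\langle\alpha_r,\alpha_r\rangle}$. Fix $\mu\in\Lambda$. For $n=(n_1,\dots,n_r)\in\mathbb{Z}^r$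 put $\lambda=\sum_{i=1}^r n_i\alpha_i$, and for $H\in V$ let $$\chi(n,H)=\frac{\sum_{s\in W}\det(s)\,e^{i\langle s(\lambda+\mu),H\rangle}}{\sum_{s\in W}\det(s)\,e^{i\langle s(\rho),H\rangle}},$$ where at the zeros of the denominator (the chamber walls) the quotient is understood as its limit from the complement of the walls. Then the denominator equals $e^{-i\langle\rho,H\rangle}\prod_{\alpha\in P}(e^{i\langle\alpha,H\rangle}-1)$ for every $H\in V$, and for every $n$ the quotient extends to a continuous function $\chi(n,\cdot)$ on all of $V$. Moreover, for all $A,B>0$ and every integer $k\geq0$ there is a constant $C>0$, depending only on $\Phi$, $\{\alpha_i\}$, $\mu$, $A$, $B$ and $k$, such that for all real $N\geq1$, all $H\in V$ with $$\left\|\tfrac{1}{2\pi}\langle\alpha,H\rangle\right\|\leq B N^{-1}\quad\text{for all }\alpha\in P$$ ($\|x\|$ being the distance from $x\in\mathbb{R}$ to the nearest integer), all $n\in\mathbb{Z}^r$ with $|n_i|\leq A N$ for $i=1,\dots,r$, and all $i_1,\dots,i_k\in\{1,\dots,r\}$, $$\left|D_{i_1}\cdots D_{i_k}\chi(n,H)\right|\leq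 C\,N^{|P|-k},$$ where $D_i$ acts on functions of $n$ by $D_if(n)=f(n+e_i)-f(n)$, with $e_i$ the $i$-th standard basis vector of $\mathbb{Z}^r$. -/

import Mathlib

open scoped InnerProductSpace BigOperators

noncomputable section

/-- The orthogonal reflection `s_α` of `V` in the hyperplane `α^⊥`. -/
def rootReflection {V : Type*} [NormedAddCommGroup V] [InnerProductSpace ℝ V]
    (α : V) : V ≃ₗᵢ[ℝ] V :=
  (ℝ ∙ α)ᗮ.reflection

theorem rootReflection_apply {V : Type*} [NormedAddCommGroup V] [InnerProductSpace ℝ V]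
    (α x : V) : rootReflection α x = x - (2 * ⟪x, α⟫_ℝ / ⟪α, α⟫_ℝ) • α := by
  unfold rootReflection
  rw [Submodule.reflection_orthogonal_apply, Submodule.reflection_singleton_apply,
    real_inner_self_eq_norm_sq, real_inner_comm]
  simp only [neg_sub, RCLike.ofReal_real_eq_id, id_eq, ← Nat.cast_smul_eq_nsmul ℝ, smul_smul]
  congr 2
  push_cast
  ring

/-- An integral root system: a finite set of vectors in a finite-dimensional real inner product
space (not assumed to span it) subject to the four axioms below. Axiom `reduced` excludes the zero
vector. -/
structure IntegralRootSystem (V : Type*) [NormedAddCommGroup V] [InnerProductSpace ℝ V] where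
  roots : Finset V
  neg_mem : ∀ α ∈ roots, -α ∈ roots
  reduced : ∀ α ∈ roots, ∀ k : ℝ, k • α ∈ roots → k = 1 ∨ k = -1
  reflection_image : ∀ α ∈ roots, (rootReflection α) '' (roots : Set V) = (roots : Set V)
  integral : ∀ α ∈ roots, ∀ β ∈ roots, ∃ m : ℤ, 2 * ⟪α, β⟫_ℝ / ⟪α, α⟫_ℝ = m

namespace IntegralRootSystem

variable {V : Type*} [NormedAddCommGroup V] [InnerProductSpace ℝ V] (R : IntegralRootSystem V)

/-- The Weyl group, generated by the reflections in the roots. -/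
def weylGroup : Subgroup (V ≃ₗᵢ[ℝ] V) :=
  Subgroup.closure {s | ∃ α ∈ R.roots, s = rootReflection α}

theorem weylGroup_image {g : V ≃ₗᵢ[ℝ] V} (hg : g ∈ R.weylGroup) :
    g '' (R.roots : Set V) = (R.roots : Set V) := by
  induction hg using Subgroup.closure_induction with
  | mem x hx =>
    obtain ⟨α, hα, rfl⟩ := hx
    exact R.reflection_image α hα
  | one => simp
  | mul x y _ _ hx hy =>
    have : (⇑(x * y) : V → V) = x ∘ y := rfl
    rw [this, Set.image_comp, hy, hx]
  | inv x _ hx =>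
    conv_lhs => rw [← hx]
    rw [← Set.image_comp]
    have : (⇑x⁻¹ ∘ ⇑x : V → V) = id := by
      funext v
      exact x.symm_apply_apply v
    rw [this, Set.image_id]

theorem weylGroup_fix {g : V ≃ₗᵢ[ℝ] V} (hg : g ∈ R.weylGroup) :
    ∀ x : V, (∀ α ∈ R.roots, ⟪x, α⟫_ℝ = 0) → g x = x := by
  induction hg using Subgroup.closure_induction with
  | mem g hg =>
    obtain ⟨α, hα, rfl⟩ := hg
    intro x hx
    rw [rootReflection_apply, hx α hα]
    simp
  | one => intro x _; rfl
  | mul a b _ _ ha hb =>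
    intro x hx
    change a (b x) = x
    rw [hb x hx, ha x hx]
  | inv a _ ha =>
    intro x hx
    change a.symm x = x
    rw [LinearIsometryEquiv.symm_apply_eq, ha x hx]

instance finite_weylGroup : Finite R.weylGroup := by
  let f : R.weylGroup → (R.roots → R.roots) := fun g α =>
    ⟨g.1 α.1, by
      have h := R.weylGroup_image g.2
      have h' : g.1 α.1 ∈ g.1 '' (R.roots : Set V) := ⟨α.1, α.2, rfl⟩
      rw [h] at h'
      exact h'⟩
  refine Finite.of_injective f ?_
  intro g h hgh
  have hroot : ∀ α ∈ R.roots, g.1 α = h.1 α := fun α hα =>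
    congrArg Subtype.val (congrFun hgh ⟨α, hα⟩)
  have hspan : ∀ x ∈ Submodule.span ℝ (R.roots : Set V), g.1 x = h.1 x := by
    intro x hx
    induction hx using Submodule.span_induction with
    | mem x hx => exact hroot x hx
    | zero => simp
    | add x y _ _ hx hy => simp [hx, hy]
    | smul c x _ hx => simp [hx]
  apply Subtype.ext
  ext x
  have : FiniteDimensional ℝ (Submodule.span ℝ (R.roots : Set V)) :=
    FiniteDimensional.span_finset ℝ R.roots
  obtain ⟨y, hy, z, hz, rfl⟩ :=
    (Submodule.span ℝ (R.roots : Set V)).exists_add_mem_mem_orthogonal x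
  have hz' : ∀ α ∈ R.roots, ⟪z, α⟫_ℝ = 0 := fun α hα => by
    rw [real_inner_comm]
    exact (Submodule.mem_orthogonal _ _).1 hz α (Submodule.subset_span hα)
  rw [map_add, map_add, hspan y hy, R.weylGroup_fix g.2 z hz', R.weylGroup_fix h.2 z hz']

instance fintypeWeylGroup : Fintype R.weylGroup := Fintype.ofFinite _

/-- `a₁, …, a_r` is a system of simple roots: linearly independent roots such that every root is an
integer combination of them with coefficients all `≥ 0` or all `≤ 0`. -/
structure IsSimpleSystem {r : ℕ} (a : Fin r → V) : Prop where
  mem_roots : ∀ i, a i ∈ R.roots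
  linearIndependent : LinearIndependent ℝ a
  nonneg_or_nonpos : ∀ α ∈ R.roots, ∃ c : Fin r → ℕ,
    α = ∑ i, (c i : ℝ) • a i ∨ α = -∑ i, (c i : ℝ) • a i

open Classical in
/-- The set `P` of positive roots attached to a system of simple roots. -/
def positiveRoots {r : ℕ} (a : Fin r → V) : Finset V :=
  R.roots.filter fun α => ∃ c : Fin r → ℕ, α = ∑ i, (c i : ℝ) • a i

/-- The half-sum `ρ` of the positive roots. -/
def rho {r : ℕ} (a : Fin r → V) : V := (1 / 2 : ℝ) • ∑ α ∈ R.positiveRoots a, α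

/-- The alternating sum `∑_{s ∈ W} det(s) e^{i⟨s ν, H⟩}`. -/
def alternatingSum (ν H : V) : ℂ :=
  ∑ s : R.weylGroup,
    ((LinearMap.det (s.1.toLinearEquiv : V →ₗ[ℝ] V) : ℝ) : ℂ) *
      Complex.exp (Complex.I * ((⟪s.1 ν, H⟫_ℝ : ℝ) : ℂ))

/-- The Weyl denominator in product form, `e^{-i⟨ρ, H⟩} ∏_{α ∈ P} (e^{i⟨α, H⟩} - 1)`. -/
def denominatorProduct {r : ℕ} (a : Fin r → V) (H : V) : ℂ :=
  Complex.exp (-(Complex.I * ((⟪R.rho a, H⟫_ℝ : ℝ) : ℂ))) *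
    ∏ α ∈ R.positiveRoots a, (Complex.exp (Complex.I * ((⟪α, H⟫_ℝ : ℝ) : ℂ)) - 1)

/-- The Weyl character `χ_ν(H)`: the quotient
`∑ det(s) e^{i⟨sν, H⟩} / ∑ det(s) e^{i⟨sρ, H⟩}` where the denominator does not vanish, extended by
continuity (as a limit) to the chamber walls, where the quotient reads `0 / 0`. -/
def weylCharacter {r : ℕ} (a : Fin r → V) (ν : V) : V → ℂ :=
  extendFrom {H | R.alternatingSum (R.rho a) H ≠ 0}
    fun H => R.alternatingSum ν H / R.alternatingSum (R.rho a) H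

end IntegralRootSystem

/-- The weight lattice attached to the simple roots `a₁, …, a_r`: the vectors `μ` of their real span
with `2⟨μ, a_j⟩ / ⟨a_j, a_j⟩ ∈ ℤ` for all `j`. By `weightLattice_eq_closure` it is the lattice
`ℤ w₁ + ⋯ + ℤ w_r` generated by the fundamental weights. -/
def weightLattice {V : Type*} [NormedAddCommGroup V] [InnerProductSpace ℝ V] {r : ℕ}
    (a : Fin r → V) : AddSubgroup V where
  carrier := {μ | μ ∈ Submodule.span ℝ (Set.range a) ∧
    ∀ j, ∃ m : ℤ, 2 * ⟪μ, a j⟫_ℝ / ⟪a j, a j⟫_ℝ = m}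
  zero_mem' := ⟨Submodule.zero_mem _, fun _ => ⟨0, by simp⟩⟩
  add_mem' := by
    rintro x y ⟨hx, hx'⟩ ⟨hy, hy'⟩
    refine ⟨Submodule.add_mem _ hx hy, fun j => ?_⟩
    obtain ⟨m, hm⟩ := hx' j
    obtain ⟨n, hn⟩ := hy' j
    refine ⟨m + n, ?_⟩
    push_cast
    rw [← hm, ← hn, inner_add_left]
    ring
  neg_mem' := by
    rintro x ⟨hx, hx'⟩
    refine ⟨Submodule.neg_mem _ hx, fun j => ?_⟩
    obtain ⟨m, hm⟩ := hx' j
    refine ⟨-m, ?_⟩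
    push_cast
    rw [← hm, inner_neg_left]
    ring

/-- If `w₁, …, w_r` is the basis of the span of the simple roots dual to the simple coroots
`2 a_j / ⟨a_j, a_j⟩`, then the weight lattice is `ℤ w₁ + ⋯ + ℤ w_r`. -/
theorem weightLattice_eq_closure {V : Type*} [NormedAddCommGroup V] [InnerProductSpace ℝ V] {r : ℕ}
    (a w : Fin r → V) (ha : LinearIndependent ℝ a)
    (hw : ∀ i, w i ∈ Submodule.span ℝ (Set.range a))
    (hdual : ∀ i j, 2 * ⟪w i, a j⟫_ℝ / ⟪a j, a j⟫_ℝ = if i = j then 1 else 0) :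
    weightLattice a = AddSubgroup.closure (Set.range w) := by
  apply le_antisymm
  · rintro μ ⟨hμ, hμ'⟩
    choose m hm using hμ'
    have key : μ = ∑ i, m i • w i := by
      have hmem : μ - ∑ i, m i • w i ∈ Submodule.span ℝ (Set.range a) :=
        Submodule.sub_mem _ hμ (Submodule.sum_mem _ fun i _ =>
          zsmul_mem (hw i) (m i))
      have horth : ∀ j, ⟪μ - ∑ i, m i • w i, a j⟫_ℝ = 0 := by
        intro j
        have hne : ⟪a j, a j⟫_ℝ ≠ 0 := inner_self_ne_zero.2 (ha.ne_zero j)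
        have h1 : 2 * ⟪μ - ∑ i, m i • w i, a j⟫_ℝ / ⟪a j, a j⟫_ℝ = 0 := by
          rw [inner_sub_left, sum_inner, mul_sub, sub_div, hm j, Finset.mul_sum, Finset.sum_div]
          have : ∀ i, 2 * ⟪m i • w i, a j⟫_ℝ / ⟪a j, a j⟫_ℝ = if i = j then (m i : ℝ) else 0 := by
            intro i
            rw [← Int.cast_smul_eq_zsmul ℝ, real_inner_smul_left,
              show 2 * ((m i : ℝ) * ⟪w i, a j⟫_ℝ) / ⟪a j, a j⟫_ℝ =
                (m i : ℝ) * (2 * ⟪w i, a j⟫_ℝ / ⟪a j, a j⟫_ℝ) by ring, hdual i j]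
            simp
          rw [Finset.sum_congr rfl fun i _ => this i]
          simp
        have h2 := (div_eq_zero_iff.1 h1).resolve_right hne
        linarith
      have hall : ∀ y ∈ Submodule.span ℝ (Set.range a), ⟪μ - ∑ i, m i • w i, y⟫_ℝ = 0 := by
        intro y hy
        induction hy using Submodule.span_induction with
        | mem y hy => obtain ⟨j, rfl⟩ := hy; exact horth j
        | zero => simp
        | add x y _ _ hx hy => rw [inner_add_right, hx, hy, add_zero]
        | smul c x _ hx => rw [real_inner_smul_right, hx, mul_zero]
      exact sub_eq_zero.1 (inner_self_eq_zero.1 (hall _ hmem))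
    rw [key]
    exact AddSubgroup.sum_mem _ fun i _ =>
      AddSubgroup.zsmul_mem _ (AddSubgroup.subset_closure (Set.mem_range_self i)) _
  · rw [AddSubgroup.closure_le]
    rintro _ ⟨i, rfl⟩
    refine ⟨hw i, fun j => ⟨if i = j then 1 else 0, ?_⟩⟩
    rw [hdual i j]
    split_ifs <;> simp

/-- The iterated difference `D_{i₁} ⋯ D_{i_k} f` for the list `[i₁, …, i_k]`, where
`D_i f (n) = f (n + e_i) - f (n)`. -/
def iteratedDifference {r : ℕ} : List (Fin r) → ((Fin r → ℤ) → ℂ) → ((Fin r → ℤ) → ℂ)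
  | [], f => f
  | i :: l, f => fwdDiff (Pi.single i (1 : ℤ)) (iteratedDifference l f)

end

/-! Work in the group algebra of `V`. For a weight `ν`, the sum `∑ det(s) e^{sν}` vanishes once
exponents are read modulo `ℤα`, because `s_α` pairs its terms with opposite signs. Hence `e^α - 1`
divides it, and since distinct positive roots are independent, so does the product over `P`
(`prod_dvd_formalAlternatingSum`). For `ν = ρ`, comparing heights leaves only `e^{-ρ}` as cofactor,
which is the denominator formula (`formalAlternatingSum_rho`). So every `χ(n, ·)` is a finite
exponential sum: continuous on `V` and entire along complex lines.

For the estimate, dividing at `H` itself fails near the walls. Move instead along `H + zδ`, where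
`⟨ν, δ⟩` is the height of `ν` and `z` is complex. Let `b = 2πB/N`, so every `⟨α, H⟩` is `b`-close to
`2πℤ`. On `|z| = 2b` each `e^{i⟨α, ·⟩}` is `e^u` with `|u|` of exact order `b`, as heights of
positive roots are at least 1. There the denominator is at least a constant times `b^{|P|}`. It does
not depend on `n`, so differences act on the numerator alone, each contributing a factor `e^{i⟨s
a_i, ·⟩} - 1 = O(b)`; the remaining exponentials are bounded, the heights being `O(N)`. The maximum
principle carries the bound `O(b^{k-|P|})` to `z = 0` (`norm_iteratedDifference_mul_pow_le`). It
needs `b` small; for bounded `N` only finitely many `n` occur and a crude bound suffices. -/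

noncomputable section

/-! ### Divisibility in group algebras -/

namespace AddMonoidAlgebra

variable {A : Type*} [AddCommGroup A]

/-- The coefficients of `(e^x - 1) G`. -/
theorem coeff_single_sub_one_mul (x y : A) (G : AddMonoidAlgebra ℂ A) :
    ((single x 1 - 1) * G).coeff y = G.coeff (y - x) - G.coeff y := by
  rw [sub_mul, one_mul]
  change (single x 1 * G).coeff y - G.coeff y = _
  congr 1
  have h := coeff_single_mul_add (r := (1 : ℂ)) (m := x) (x := G) (m' := y - x)
  simpa using h

/-- If `x` has infinite order, then `e^x - 1` is not a zero divisor. -/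
theorem eq_zero_of_single_sub_one_mul_eq_zero {x : A} (hx : ∀ m : ℤ, m • x = 0 → m = 0)
    {G : AddMonoidAlgebra ℂ A} (h : (single x 1 - 1) * G = 0) : G = 0 := by
  have hstep : ∀ y, G.coeff (y - x) = G.coeff y := fun y => by
    have := coeff_single_sub_one_mul x y G
    rw [h] at this
    exact sub_eq_zero.1 (this.symm.trans rfl)
  -- Coefficients are constant along `y + ℕx`, so a nonzero one would make the support infinite.
  have hiter : ∀ (n : ℕ) (y), G.coeff (y + n • x) = G.coeff y := by
    intro n
    induction n with
    | zero => simp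
    | succ n ih =>
      intro y
      rw [← ih y, ← hstep (y + (n + 1) • x)]
      congr 1
      rw [succ_nsmul]
      abel
  ext y
  by_contra hy
  refine Set.infinite_of_injective_forall_mem (f := fun n : ℕ => y + n • x) ?_ ?_
    (G.coeff.support.finite_toSet)
  · intro m n hmn
    have h1 : m • x = n • x := add_left_cancel hmn
    have h2 := hx ((m : ℤ) - n) (by rw [sub_smul, natCast_zsmul, natCast_zsmul, h1, sub_self])
    omega
  · intro n
    simpa [hiter n y] using hy

/-- The restriction of exponents to the quotient by `ℤ x`. -/
def modZMultiples (x : A) :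
    AddMonoidAlgebra ℂ A →+* AddMonoidAlgebra ℂ (A ⧸ AddSubgroup.zmultiples x) :=
  mapDomainRingHom ℂ (QuotientAddGroup.mk' (AddSubgroup.zmultiples x))

theorem modZMultiples_single (x y : A) (c : ℂ) :
    modZMultiples x (single y c) = single (y : A ⧸ AddSubgroup.zmultiples x) c := by
  simp [modZMultiples]

theorem single_sub_one_dvd_single_zsmul_sub_one (x : A) (m : ℤ) :
    (single x 1 - 1 : AddMonoidAlgebra ℂ A) ∣ single (m • x) 1 - 1 := by
  have hnat : ∀ n : ℕ, (single x 1 - 1 : AddMonoidAlgebra ℂ A) ∣ single (n • x) 1 - 1 := by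
    intro n
    have := sub_one_dvd_pow_sub_one (single x 1 : AddMonoidAlgebra ℂ A) n
    rwa [single_pow, one_pow] at this
  obtain ⟨n, rfl | rfl⟩ := m.eq_nat_or_neg
  · simpa using hnat n
  · have : (single (-(n : ℤ) • x) 1 - 1 : AddMonoidAlgebra ℂ A) =
        -single (-(n : ℤ) • x) 1 * (single (n • x) 1 - 1) := by
      rw [mul_sub, neg_mul, single_mul_single]
      simp [one_def, neg_add_eq_sub]
    rw [this]
    exact Dvd.dvd.mul_left (hnat n) _

/-- The kernel of the restriction of exponents modulo `ℤ x` is generated by `e^x - 1`. -/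
theorem single_sub_one_dvd_of_modZMultiples_eq_zero {x : A} {G : AddMonoidAlgebra ℂ A}
    (h : modZMultiples x G = 0) : (single x 1 - 1) ∣ G := by
  classical
  -- Moving each exponent to a chosen representative of its class changes `F` only by multiples of
  -- `e^x - 1`.
  have key : ∀ F : AddMonoidAlgebra ℂ A, (single x 1 - 1) ∣
      F - mapDomain (fun q : A ⧸ AddSubgroup.zmultiples x => q.out) (modZMultiples x F) := by
    intro F
    induction F using AddMonoidAlgebra.induction_linear with
    | zero => simp
    | add f g hf hg =>
      rw [map_add, mapDomain_add, add_sub_add_comm]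
      exact dvd_add hf hg
    | single y c =>
      rw [modZMultiples_single, mapDomain_single]
      obtain ⟨⟨z, hz⟩, hz'⟩ := QuotientAddGroup.mk_out_eq_add (AddSubgroup.zmultiples x) y
      obtain ⟨m, rfl⟩ := AddSubgroup.mem_zmultiples_iff.1 hz
      rw [hz']
      have : (single y c - single (y + m • x) c : AddMonoidAlgebra ℂ A) =
          -single y c * (single (m • x) 1 - 1) := by
        rw [mul_sub, neg_mul, single_mul_single]
        simp [neg_add_eq_sub]
      rw [this]
      exact Dvd.dvd.mul_left (single_sub_one_dvd_single_zsmul_sub_one x m) _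
  have := key G
  rwa [h, mapDomain_zero, sub_zero] at this

/-- An element that vanishes modulo `ℤ x` for every `x` in a set of pairwise independent vectors
is divisible by the product of the `e^x - 1`. -/
theorem prod_single_sub_one_dvd (S : Finset A)
    (hS : ∀ x ∈ S, ∀ y ∈ S, x ≠ y → ∀ m n : ℤ, m • x = n • y → m = 0)
    {F : AddMonoidAlgebra ℂ A} (hF : ∀ x ∈ S, modZMultiples x F = 0) :
    (∏ x ∈ S, (single x 1 - 1)) ∣ F := by
  classical
  induction S using Finset.induction_on with
  | empty => simp
  | insert x S hx ih =>
    obtain ⟨G, rfl⟩ := ih (fun y hy z hz => hS y (by simp [hy]) z (by simp [hz]))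
      (fun y hy => hF y (by simp [hy]))
    have h0 := hF x (by simp)
    rw [map_mul, map_prod] at h0
    have hG : modZMultiples x G = 0 := by
      have hne : ∀ y ∈ S, y ≠ x := fun y hy h => hx (h ▸ hy)
      have hind : ∀ y ∈ S, ∀ m n : ℤ, m • y = n • x → m = 0 := fun y hy =>
        hS y (by simp [hy]) x (by simp) (hne y hy)
      clear ih hS hF hne hx
      -- Modulo `ℤx` each `y ∈ S` still has infinite order, so the factors `e^y - 1` can be
      -- cancelled one at a time.
      generalize modZMultiples x G = G' at h0
      induction S using Finset.induction_on with
      | empty => simpa using h0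
      | insert y S hy ih =>
        refine ih (fun z hz => hind z (by simp [hz])) ?_
        rw [Finset.prod_insert hy, mul_assoc, map_sub, map_one, modZMultiples_single] at h0
        refine eq_zero_of_single_sub_one_mul_eq_zero ?_ h0
        intro m hm
        rw [← QuotientAddGroup.mk_zsmul, QuotientAddGroup.eq_zero_iff] at hm
        obtain ⟨n, hn⟩ := AddSubgroup.mem_zmultiples_iff.1 hm
        exact hind y (by simp) m n hn.symm
    obtain ⟨G', rfl⟩ := single_sub_one_dvd_of_modZMultiples_eq_zero hG
    rw [Finset.prod_insert hx]
    exact ⟨G', by ring⟩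

/-- Dividing by `∏ (e^x - 1)` shrinks the range of heights in the support, and the top part of a
multiple of `∏ (e^x - 1)` is a shift of the top part of the cofactor. -/
theorem heights_of_prod_mul (ht : A →+ ℝ) (S : Finset A) (hS : ∀ x ∈ S, 0 < ht x)
    (G : AddMonoidAlgebra ℂ A) (b t : ℝ)
    (h : ∀ y, ((∏ x ∈ S, (single x 1 - 1)) * G).coeff y ≠ 0 → b ≤ ht y ∧ ht y ≤ t) :
    (∀ y, G.coeff y ≠ 0 → b ≤ ht y ∧ ht y ≤ t - ht (∑ x ∈ S, x)) ∧
      ∀ y, ht y = t - ht (∑ x ∈ S, x) →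
        G.coeff y = ((∏ x ∈ S, (single x 1 - 1)) * G).coeff (y + ∑ x ∈ S, x) := by
  classical
  induction S using Finset.induction_on generalizing G with
  | empty => simpa using h
  | insert x S hx ih =>
    have hx0 := hS x (by simp)
    -- The new factor joins the cofactor, so the induction hypothesis applies to `(e^x - 1) G`.
    have hassoc : (∏ z ∈ insert x S, (single z 1 - 1)) * G =
        (∏ z ∈ S, (single z 1 - 1)) * ((single x 1 - 1) * G) := by
      rw [Finset.prod_insert hx]; ring
    rw [hassoc] at h ⊢
    obtain ⟨h1, h2⟩ := ih (fun z hz => hS z (by simp [hz])) _ h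
    rw [Finset.sum_insert hx, map_add]
    have hbound : ∀ y, G.coeff y ≠ 0 → b ≤ ht y ∧ ht y ≤ t - (ht x + ht (∑ z ∈ S, z)) := by
      intro y hy
      have hne : G.coeff.support.Nonempty := ⟨y, by simpa using hy⟩
      -- With `u` highest and `l` lowest in the support of `G`, neither `u + x` nor `l` can cancel
      -- in `(e^x - 1) G`.
      obtain ⟨u, hu, hu'⟩ := Finset.exists_max_image _ ht hne
      obtain ⟨l, hl, hl'⟩ := Finset.exists_min_image _ ht hne
      constructor
      · refine le_trans ?_ (hl' y (by simpa using hy))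
        refine (h1 l ?_).1
        rw [coeff_single_sub_one_mul]
        have : G.coeff (l - x) = 0 := by
          by_contra hc
          have := hl' (l - x) (by simpa using hc)
          rw [map_sub] at this
          linarith
        rw [this, zero_sub, neg_ne_zero]
        simpa using hl
      · have := (h1 (u + x) (by
          rw [coeff_single_sub_one_mul, add_sub_cancel_right]
          have : G.coeff (u + x) = 0 := by
            by_contra hc
            have := hu' (u + x) (by simpa using hc)
            rw [map_add] at this
            linarith
          rw [this, sub_zero]
          simpa using hu)).2
        rw [map_add] at this
        have := hu' y (by simpa using hy)
        linarith
    refine ⟨hbound, fun y hy => ?_⟩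
    rw [← add_assoc, ← h2 (y + x) (by rw [map_add]; linarith), coeff_single_sub_one_mul,
      add_sub_cancel_right]
    have : G.coeff (y + x) = 0 := by
      by_contra hc
      have := (hbound _ hc).2
      rw [map_add] at this
      linarith
    rw [this, sub_zero]

/-- Evaluation of a formal exponential sum at an additive functional: `e^v ↦ exp (φ v)`. -/
def expEval (φ : A →+ ℂ) : AddMonoidAlgebra ℂ A →ₐ[ℂ] ℂ :=
  lift ℂ ℂ A
    { toFun := fun v => Complex.exp (φ v.toAdd)
      map_one' := by simp
      map_mul' := fun v w => by simp [Complex.exp_add] }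

theorem expEval_single (φ : A →+ ℂ) (v : A) (c : ℂ) :
    expEval φ (single v c) = c * Complex.exp (φ v) := by
  simp [expEval]

end AddMonoidAlgebra


/-! ### Root systems -/

section Reflection

variable {V : Type*} [NormedAddCommGroup V] [InnerProductSpace ℝ V]

theorem rootReflection_neg (α : V) : rootReflection (-α) = rootReflection α := by
  ext x
  simp [rootReflection_apply, neg_div, sub_eq_add_neg]

theorem rootReflection_conj (g : V ≃ₗᵢ[ℝ] V) (α : V) :
    rootReflection (g α) = g * rootReflection α * g⁻¹ := by
  ext x
  change _ = g (rootReflection α (g.symm x))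
  have h : ⟪x, g α⟫_ℝ = ⟪g.symm x, α⟫_ℝ := by
    rw [← g.inner_map_map (g.symm x) α, g.apply_symm_apply]
  rw [rootReflection_apply, rootReflection_apply, map_sub, map_smul, g.apply_symm_apply,
    g.inner_map_map, h]

theorem rootReflection_mul_self (α : V) : rootReflection α * rootReflection α = 1 := by
  unfold rootReflection
  exact Submodule.reflection_mul_reflection _

theorem rootReflection_apply_self {α : V} (hα : α ≠ 0) : rootReflection α α = -α := by
  have : ⟪α, α⟫_ℝ ≠ 0 := inner_self_ne_zero.2 hα
  rw [rootReflection_apply, mul_div_assoc, div_self this, mul_one, two_smul]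
  abel

theorem det_rootReflection [FiniteDimensional ℝ V] {α : V} (hα : α ≠ 0) :
    LinearMap.det ((rootReflection α).toLinearEquiv : V →ₗ[ℝ] V) = -1 := by
  have h := Submodule.det_reflection (ℝ ∙ α)ᗮ
  rw [Submodule.orthogonal_orthogonal, finrank_span_singleton hα, pow_one] at h
  exact h

end Reflection

namespace IntegralRootSystem

variable {V : Type*} [NormedAddCommGroup V] [InnerProductSpace ℝ V] (R : IntegralRootSystem V)

theorem ne_zero_of_mem {α : V} (hα : α ∈ R.roots) : α ≠ 0 := by
  rintro rfl
  have := R.reduced 0 hα 2 (by simpa using hα)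
  norm_num at this

theorem apply_mem_roots {g : V ≃ₗᵢ[ℝ] V} (hg : g ∈ R.weylGroup) {α : V} (hα : α ∈ R.roots) :
    g α ∈ R.roots := by
  have h : g α ∈ g '' (R.roots : Set V) := ⟨α, hα, rfl⟩
  rwa [R.weylGroup_image hg] at h

theorem rootReflection_mem_weylGroup {α : V} (hα : α ∈ R.roots) :
    rootReflection α ∈ R.weylGroup :=
  Subgroup.subset_closure ⟨α, hα, rfl⟩

theorem mem_positiveRoots {r : ℕ} {a : Fin r → V} {α : V} :
    α ∈ R.positiveRoots a ↔ α ∈ R.roots ∧ ∃ c : Fin r → ℕ, α = ∑ i, (c i : ℝ) • a i := by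
  classical
  simp [positiveRoots]

/-- The product of the simple reflections indexed by a list. -/
def simpleWord {r : ℕ} (a : Fin r → V) (L : List (Fin r)) : V ≃ₗᵢ[ℝ] V :=
  (L.map fun i => rootReflection (a i)).prod

theorem simpleWord_cons {r : ℕ} (a : Fin r → V) (i : Fin r) (L : List (Fin r)) :
    simpleWord a (i :: L) = rootReflection (a i) * simpleWord a L := by
  simp [simpleWord]

theorem simpleWord_append {r : ℕ} (a : Fin r → V) (L M : List (Fin r)) :
    simpleWord a (L ++ M) = simpleWord a L * simpleWord a M := by
  simp [simpleWord]

theorem simpleWord_reverse {r : ℕ} (a : Fin r → V) (L : List (Fin r)) :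
    simpleWord a L.reverse = (simpleWord a L)⁻¹ := by
  induction L with
  | nil => simp [simpleWord]
  | cons i L ih =>
    rw [List.reverse_cons, simpleWord_append, simpleWord_cons a i L, mul_inv_rev, ih,
      simpleWord_cons,
      inv_eq_of_mul_eq_one_left (rootReflection_mul_self (a i))]
    simp [simpleWord]

namespace IsSimpleSystem

variable {R} {r : ℕ} {a : Fin r → V}

/-- The coordinates with respect to the simple roots extend to linear functionals on `V`. -/
theorem exists_coord (ha : R.IsSimpleSystem a) :
    ∃ co : V →ₗ[ℝ] (Fin r → ℝ), ∀ c : Fin r → ℝ, co (∑ i, c i • a i) = c := by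
  obtain ⟨g, hg⟩ := (Fintype.linearCombination ℝ a).exists_leftInverse_of_injective
    (LinearMap.ker_eq_bot.2
      (linearIndependent_iff_injective_fintypeLinearCombination.1 ha.linearIndependent))
  exact ⟨g, fun c => by simpa [Fintype.linearCombination_apply] using LinearMap.congr_fun hg c⟩

/-- Coordinates with respect to a system of simple roots, extended linearly to `V`. -/
def coord (ha : R.IsSimpleSystem a) : V →ₗ[ℝ] (Fin r → ℝ) := ha.exists_coord.choose

theorem coord_sum (ha : R.IsSimpleSystem a) (c : Fin r → ℝ) : ha.coord (∑ i, c i • a i) = c :=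
  ha.exists_coord.choose_spec c

theorem coord_simple (ha : R.IsSimpleSystem a) (i : Fin r) :
    ha.coord (a i) = Pi.single i 1 := by
  have h := ha.coord_sum (Pi.single i 1)
  simpa [Pi.single_apply] using h

theorem sum_coord_smul (ha : R.IsSimpleSystem a) {α : V} (hα : α ∈ R.roots) :
    ∑ i, ha.coord α i • a i = α := by
  obtain ⟨c, rfl | rfl⟩ := ha.nonneg_or_nonpos α hα
  · rw [ha.coord_sum]
  · rw [map_neg, ha.coord_sum]
    simp

theorem mem_positiveRoots_iff (ha : R.IsSimpleSystem a) {α : V} :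
    α ∈ R.positiveRoots a ↔ α ∈ R.roots ∧ ∀ i, 0 ≤ ha.coord α i := by
  rw [R.mem_positiveRoots]
  refine and_congr_right fun hα => ⟨?_, fun h => ?_⟩
  · rintro ⟨c, rfl⟩ i
    rw [ha.coord_sum]
    positivity
  · obtain ⟨c, hc | hc⟩ := ha.nonneg_or_nonpos α hα
    · exact ⟨c, hc⟩
    · refine ⟨0, ?_⟩
      rw [hc, map_neg, ha.coord_sum] at h
      have : ∀ i, (c i : ℝ) = 0 := fun i =>
        le_antisymm (by simpa using h i) (by positivity)
      rw [hc]
      simp [this]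

theorem positiveRoots_subset (ha : R.IsSimpleSystem a) {α : V} (h : α ∈ R.positiveRoots a) :
    α ∈ R.roots := (ha.mem_positiveRoots_iff.1 h).1

theorem mem_or_neg_mem (ha : R.IsSimpleSystem a) {α : V} (hα : α ∈ R.roots) :
    α ∈ R.positiveRoots a ∨ -α ∈ R.positiveRoots a := by
  obtain ⟨c, hc | hc⟩ := ha.nonneg_or_nonpos α hα
  · exact Or.inl (R.mem_positiveRoots.2 ⟨hα, c, hc⟩)
  · exact Or.inr (R.mem_positiveRoots.2 ⟨R.neg_mem α hα, c, by rw [hc, neg_neg]⟩)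

theorem mem_positiveRoots_of_coord_pos (ha : R.IsSimpleSystem a) {α : V} (hα : α ∈ R.roots)
    {i : Fin r} (hi : 0 < ha.coord α i) : α ∈ R.positiveRoots a := by
  rcases ha.mem_or_neg_mem hα with h | h
  · exact h
  · have := (ha.mem_positiveRoots_iff.1 h).2 i
    rw [map_neg, Pi.neg_apply] at this
    linarith

theorem simple_mem_positiveRoots (ha : R.IsSimpleSystem a) (i : Fin r) :
    a i ∈ R.positiveRoots a :=
  ha.mem_positiveRoots_of_coord_pos (ha.mem_roots i) (i := i) (by simp [ha.coord_simple])

/-- The height: the sum of the coordinates with respect to the simple roots. -/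
def height (ha : R.IsSimpleSystem a) : V →ₗ[ℝ] ℝ :=
  (∑ i, LinearMap.proj i) ∘ₗ ha.coord

theorem height_apply (ha : R.IsSimpleSystem a) (v : V) : ha.height v = ∑ i, ha.coord v i := by
  simp [height]

theorem height_simple (ha : R.IsSimpleSystem a) (i : Fin r) : ha.height (a i) = 1 := by
  simp [height_apply, ha.coord_simple]

/-- The coordinates are natural numbers, not all zero. This gap keeps the denominator away from zero
on the circle `|z| = 2b`. -/
theorem one_le_height (ha : R.IsSimpleSystem a) {α : V} (hα : α ∈ R.positiveRoots a) :
    1 ≤ ha.height α := by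
  obtain ⟨h, c, hc⟩ := R.mem_positiveRoots.1 hα
  have hne : c ≠ 0 := by
    rintro rfl
    exact R.ne_zero_of_mem h (by simpa using hc)
  obtain ⟨i, hi⟩ := Function.ne_iff.1 hne
  have hi1 : 1 ≤ c i := Nat.one_le_iff_ne_zero.2 hi
  rw [ha.height_apply, hc, ha.coord_sum]
  calc (1 : ℝ) ≤ c i := by exact_mod_cast hi1
    _ ≤ ∑ j, (c j : ℝ) := Finset.single_le_sum (f := fun j => (c j : ℝ))
      (fun j _ => by positivity) (Finset.mem_univ i)

theorem neg_notMem (ha : R.IsSimpleSystem a) {α : V} (hα : α ∈ R.positiveRoots a) :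
    -α ∉ R.positiveRoots a := fun h => by
  have h1 := ha.one_le_height hα
  have h2 := ha.one_le_height h
  rw [map_neg] at h2
  linarith

theorem mem_positiveRoots_of_height_nonneg (ha : R.IsSimpleSystem a) {α : V}
    (hα : α ∈ R.roots) (h : 0 ≤ ha.height α) : α ∈ R.positiveRoots a := by
  rcases ha.mem_or_neg_mem hα with h' | h'
  · exact h'
  · have := ha.one_le_height h'
    rw [map_neg] at this
    linarith

/-- The independence needed by `prod_single_sub_one_dvd`: reducedness leaves only `α = ±β`, and
positivity excludes `-β`. -/
theorem eq_zero_of_zsmul_eq_zsmul (ha : R.IsSimpleSystem a) {α β : V}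
    (hα : α ∈ R.positiveRoots a) (hβ : β ∈ R.positiveRoots a) (hne : α ≠ β) (m n : ℤ)
    (h : m • α = n • β) : m = 0 := by
  by_contra hm
  have hm' : (m : ℝ) ≠ 0 := by exact_mod_cast hm
  have hαβ : α = ((n : ℝ) / m) • β := by
    rw [← Int.cast_smul_eq_zsmul ℝ, ← Int.cast_smul_eq_zsmul ℝ] at h
    rw [div_eq_inv_mul, mul_smul, ← h, smul_smul, inv_mul_cancel₀ hm', one_smul]
  rcases R.reduced β (ha.positiveRoots_subset hβ) _
    (hαβ ▸ ha.positiveRoots_subset hα) with h1 | h1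
  · exact hne (by rw [hαβ, h1, one_smul])
  · rw [h1, neg_one_smul] at hαβ
    exact ha.neg_notMem hβ (hαβ ▸ hα)

/-! ### Words in simple reflections and the exchange condition. -/

/-- A simple reflection permutes the positive roots other than the simple root. -/
theorem rootReflection_simple_mem (ha : R.IsSimpleSystem a) {α : V}
    (hα : α ∈ R.positiveRoots a) {i : Fin r} (hne : α ≠ a i) :
    rootReflection (a i) α ∈ R.positiveRoots a := by
  have hroot := ha.positiveRoots_subset hα
  have hnn := (ha.mem_positiveRoots_iff.1 hα).2
  -- Otherwise `α` is a multiple of `a i`, hence equal to it. The reflection leaves coordinate `j`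
  -- unchanged, and one positive coordinate makes a root positive.
  obtain ⟨j, hji, hj⟩ : ∃ j, j ≠ i ∧ 0 < ha.coord α j := by
    by_contra! hcon
    have hα' : α = ha.coord α i • a i := by
      conv_lhs => rw [← ha.sum_coord_smul hroot]
      refine Finset.sum_eq_single i (fun j _ hj => ?_) (by simp)
      rw [le_antisymm (hcon j hj) (hnn j), zero_smul]
    rcases R.reduced (a i) (ha.mem_roots i) _ (hα' ▸ hroot) with h | h
    · exact hne (by rw [hα', h, one_smul])
    · linarith [hnn i]
  refine ha.mem_positiveRoots_of_coord_pos (i := j)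
    (R.apply_mem_roots (R.rootReflection_mem_weylGroup (ha.mem_roots i)) hroot) ?_
  rw [rootReflection_apply, map_sub, map_smul, ha.coord_simple]
  simpa [hji] using hj

theorem simple_ne_zero (ha : R.IsSimpleSystem a) (i : Fin r) : a i ≠ 0 :=
  R.ne_zero_of_mem (ha.mem_roots i)

/-- Every positive root is the image of a simple root under a product of simple reflections. -/
theorem exists_simpleWord_apply_eq (ha : R.IsSimpleSystem a) {α : V}
    (hα : α ∈ R.positiveRoots a) : ∃ L i, α = simpleWord a L (a i) := by
  obtain ⟨n, hn⟩ := exists_nat_ge (ha.height α)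
  induction n generalizing α with
  | zero =>
    have := ha.one_le_height hα
    simp at hn
    linarith
  | succ n ih =>
    by_cases hs : ∃ i, α = a i
    · obtain ⟨i, rfl⟩ := hs
      exact ⟨[], i, rfl⟩
    push Not at hs
    have hroot := ha.positiveRoots_subset hα
    -- Expand `⟨α, α⟩ > 0` in the simple roots.
    obtain ⟨i, hi⟩ : ∃ i, 0 < ⟪a i, α⟫_ℝ := by
      by_contra! hcon
      have h1 : ⟪α, α⟫_ℝ ≤ 0 := by
        conv_lhs => rw [← ha.sum_coord_smul hroot, sum_inner]
        rw [ha.sum_coord_smul hroot]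
        refine Finset.sum_nonpos fun i _ => ?_
        rw [real_inner_smul_left]
        exact mul_nonpos_of_nonneg_of_nonpos ((ha.mem_positiveRoots_iff.1 hα).2 i) (hcon i)
      exact absurd (real_inner_self_nonpos.1 h1) (R.ne_zero_of_mem hroot)
    obtain ⟨m, hm⟩ := R.integral (a i) (ha.mem_roots i) α hroot
    have hpos : 0 < ⟪a i, a i⟫_ℝ := real_inner_self_pos.2 (ha.simple_ne_zero i)
    -- Integrality makes the reflection lower the height by at least 1, which drives the induction.
    have hm1 : (1 : ℝ) ≤ m := by
      have : (0 : ℝ) < m := by rw [← hm]; positivity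
      exact_mod_cast this
    obtain ⟨L, j, hL⟩ := ih (ha.rootReflection_simple_mem hα (hs i)) (by
      rw [rootReflection_apply, real_inner_comm, hm, map_sub, map_smul, ha.height_simple]
      push_cast at hn
      simp only [smul_eq_mul, mul_one]
      linarith)
    refine ⟨i :: L, j, ?_⟩
    rw [simpleWord_cons]
    change α = rootReflection (a i) (simpleWord a L (a j))
    rw [← hL]
    exact (congrArg (fun g : V ≃ₗᵢ[ℝ] V => g α) (rootReflection_mul_self (a i))).symm

/-- Every positive root is `w(a i)` for a word `w`, and its reflection is then the word `w s_i w⁻¹`.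
-/
theorem exists_simpleWord_eq (ha : R.IsSimpleSystem a) {g : V ≃ₗᵢ[ℝ] V}
    (hg : g ∈ R.weylGroup) : ∃ L, g = simpleWord a L := by
  induction hg using Subgroup.closure_induction with
  | mem g hg =>
    obtain ⟨α, hα, rfl⟩ := hg
    have key : ∀ α ∈ R.positiveRoots a, ∃ L, rootReflection α = simpleWord a L := by
      intro α hα
      obtain ⟨L, i, rfl⟩ := ha.exists_simpleWord_apply_eq hα
      refine ⟨L ++ i :: L.reverse, ?_⟩
      rw [rootReflection_conj, simpleWord_append, simpleWord_cons, simpleWord_reverse, mul_assoc]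
    rcases ha.mem_or_neg_mem hα with h | h
    · exact key α h
    · rw [← rootReflection_neg]
      exact key _ h
  | one => exact ⟨[], rfl⟩
  | mul x y _ _ hx hy =>
    obtain ⟨L, rfl⟩ := hx
    obtain ⟨M, rfl⟩ := hy
    exact ⟨L ++ M, (simpleWord_append a L M).symm⟩
  | inv x _ hx =>
    obtain ⟨L, rfl⟩ := hx
    exact ⟨L.reverse, (simpleWord_reverse a L).symm⟩

/-- The exchange condition. -/
theorem exchange (ha : R.IsSimpleSystem a) (L : List (Fin r)) (i : Fin r)
    (h : simpleWord a L (a i) ∉ R.positiveRoots a) :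
    ∃ M : List (Fin r), M.length + 1 = L.length ∧
      simpleWord a M = simpleWord a L * rootReflection (a i) := by
  induction L with
  | nil => exact absurd (ha.simple_mem_positiveRoots i) h
  | cons j L ih =>
    by_cases hL : simpleWord a L (a i) ∈ R.positiveRoots a
    -- A simple reflection makes only its own simple root negative. With `w` the word of `L`, `w(a
    -- i) = a j` gives `s_j = w s_i w⁻¹`, so `s_j w s_i = w` and the letter `j` drops out.
    · have hj : simpleWord a L (a i) = a j := by
        by_contra hne
        rw [simpleWord_cons] at h
        exact h (ha.rootReflection_simple_mem hL hne)
      refine ⟨L, rfl, ?_⟩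
      have := rootReflection_conj (simpleWord a L) (a i)
      rw [hj] at this
      rw [simpleWord_cons, this, inv_mul_cancel_right, mul_assoc, rootReflection_mul_self, mul_one]
    · obtain ⟨M, hM, hM'⟩ := ih hL
      exact ⟨j :: M, by simp [hM], by rw [simpleWord_cons, simpleWord_cons, hM', mul_assoc]⟩

/-- A Weyl group element that keeps the simple roots positive is trivial. -/
theorem eq_one_of_forall_mem (ha : R.IsSimpleSystem a) {g : V ≃ₗᵢ[ℝ] V} (hg : g ∈ R.weylGroup)
    (h : ∀ i, g (a i) ∈ R.positiveRoots a) : g = 1 := by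
  classical
  -- Take a shortest word. If it ends in `i`, the word before that letter sends `a i` to a negative
  -- root, and exchange gives a word for `g` two letters shorter.
  have hex : ∃ n, ∃ L : List (Fin r), L.length = n ∧ g = simpleWord a L := by
    obtain ⟨L, hL⟩ := ha.exists_simpleWord_eq hg
    exact ⟨_, L, rfl, hL⟩
  obtain ⟨L, hL, hgL⟩ := Nat.find_spec hex
  rcases List.eq_nil_or_concat L with rfl | ⟨M, i, rfl⟩
  · exact hgL
  · exfalso
    rw [List.concat_eq_append] at hL hgL
    have hgM : g = simpleWord a M * rootReflection (a i) := by
      rw [hgL, simpleWord_append]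
      simp [simpleWord]
    have hneg : simpleWord a M (a i) ∉ R.positiveRoots a := by
      have h1 : g (a i) = -simpleWord a M (a i) := by
        rw [hgM]
        change simpleWord a M (rootReflection (a i) (a i)) = _
        rw [rootReflection_apply_self (ha.simple_ne_zero i), map_neg]
      intro h2
      exact ha.neg_notMem h2 (h1 ▸ h i)
    obtain ⟨M', hM', hM''⟩ := ha.exchange M i hneg
    refine Nat.find_min hex (m := M'.length) ?_ ⟨M', rfl, hgM.trans hM''.symm⟩
    rw [← hL]
    simp
    omega

/-! ### Integral weights -/

theorem simple_mem_weightLattice (ha : R.IsSimpleSystem a) (i : Fin r) : a i ∈ weightLattice a := by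
  refine ⟨Submodule.subset_span (Set.mem_range_self i), fun j => ?_⟩
  rw [real_inner_comm]
  exact R.integral (a j) (ha.mem_roots j) (a i) (ha.mem_roots i)

theorem simpleWord_apply_mem_weightLattice (ha : R.IsSimpleSystem a) (L : List (Fin r)) {ν : V}
    (hν : ν ∈ weightLattice a) : simpleWord a L ν ∈ weightLattice a := by
  induction L with
  | nil => exact hν
  | cons i L ih =>
    rw [simpleWord_cons]
    change rootReflection (a i) (simpleWord a L ν) ∈ _
    obtain ⟨m, hm⟩ := ih.2 i
    rw [rootReflection_apply, hm, Int.cast_smul_eq_zsmul]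
    exact sub_mem ih (zsmul_mem (ha.simple_mem_weightLattice i) m)

/-- A weight pairs integrally with all coroots. -/
theorem exists_int_of_mem_weightLattice (ha : R.IsSimpleSystem a) {ν : V}
    (hν : ν ∈ weightLattice a) {α : V} (hα : α ∈ R.roots) :
    ∃ m : ℤ, 2 * ⟪ν, α⟫_ℝ / ⟪α, α⟫_ℝ = m := by
  have key : ∀ α ∈ R.positiveRoots a, ∃ m : ℤ, 2 * ⟪ν, α⟫_ℝ / ⟪α, α⟫_ℝ = m := by
    intro α hα
    obtain ⟨L, i, rfl⟩ := ha.exists_simpleWord_apply_eq hα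
    obtain ⟨m, hm⟩ := (ha.simpleWord_apply_mem_weightLattice L.reverse hν).2 i
    refine ⟨m, ?_⟩
    have h : ⟪ν, simpleWord a L (a i)⟫_ℝ = ⟪(simpleWord a L)⁻¹ ν, a i⟫_ℝ := by
      rw [← (simpleWord a L).inner_map_map _ (a i)]
      exact congrArg (fun g : V ≃ₗᵢ[ℝ] V => ⟪g ν, simpleWord a L (a i)⟫_ℝ)
        (mul_inv_cancel (simpleWord a L)).symm
    rw [← hm, LinearIsometryEquiv.inner_map_map, simpleWord_reverse, h]
  rcases ha.mem_or_neg_mem hα with h | h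
  · exact key α h
  · obtain ⟨m, hm⟩ := key _ h
    refine ⟨-m, ?_⟩
    push_cast
    rw [← hm]
    simp [neg_div]

theorem apply_mem_weightLattice (ha : R.IsSimpleSystem a) {g : V ≃ₗᵢ[ℝ] V}
    (hg : g ∈ R.weylGroup) {ν : V} (hν : ν ∈ weightLattice a) : g ν ∈ weightLattice a := by
  obtain ⟨L, rfl⟩ := ha.exists_simpleWord_eq hg
  exact ha.simpleWord_apply_mem_weightLattice L hν

/-- The reflection permutes `P \ {a i}` and negates `a i`. Hence `ρ` pairs to 1 with every simple
coroot and is a weight. -/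
theorem rootReflection_rho (ha : R.IsSimpleSystem a) (i : Fin r) :
    rootReflection (a i) (R.rho a) = R.rho a - a i := by
  classical
  have hi := ha.simple_mem_positiveRoots i
  have hinv : ∀ x, rootReflection (a i) (rootReflection (a i) x) = x := fun x =>
    congrArg (fun g : V ≃ₗᵢ[ℝ] V => g x) (rootReflection_mul_self (a i))
  have hself := rootReflection_apply_self (ha.simple_ne_zero i)
  have hmaps : ∀ α ∈ (R.positiveRoots a).erase (a i),
      rootReflection (a i) α ∈ (R.positiveRoots a).erase (a i) := by
    intro α hα
    obtain ⟨hne, hα⟩ := Finset.mem_erase.1 hα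
    refine Finset.mem_erase.2 ⟨fun h => ?_, ha.rootReflection_simple_mem hα hne⟩
    have h2 := hinv α
    rw [h, hself] at h2
    exact ha.neg_notMem hi (h2 ▸ hα)
  have hperm : ∑ α ∈ (R.positiveRoots a).erase (a i), rootReflection (a i) α =
      ∑ α ∈ (R.positiveRoots a).erase (a i), α :=
    Finset.sum_bij' (fun α _ => rootReflection (a i) α) (fun α _ => rootReflection (a i) α)
      hmaps hmaps (fun α _ => hinv α) (fun α _ => hinv α) (fun _ _ => rfl)
  rw [rho, map_smul, map_sum, ← Finset.add_sum_erase _ _ hi, ← Finset.add_sum_erase _ _ hi,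
    hperm, hself]
  module

theorem rho_mem_weightLattice (ha : R.IsSimpleSystem a) : R.rho a ∈ weightLattice a := by
  refine ⟨Submodule.smul_mem _ _ (Submodule.sum_mem _ fun α hα => ?_), fun j => ⟨1, ?_⟩⟩
  · rw [← ha.sum_coord_smul (ha.positiveRoots_subset hα)]
    exact Submodule.sum_mem _ fun i _ =>
      Submodule.smul_mem _ _ (Submodule.subset_span (Set.mem_range_self i))
  · have h := ha.rootReflection_rho j
    rw [rootReflection_apply, sub_right_inj] at h
    have h2 : (2 * ⟪R.rho a, a j⟫_ℝ / ⟪a j, a j⟫_ℝ - 1) • a j = 0 := by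
      rw [sub_smul, h, one_smul, sub_self]
    have := (smul_eq_zero.1 h2).resolve_right (ha.simple_ne_zero j)
    push_cast
    linarith

/-! ### Heights on the Weyl orbit of `ρ`. -/

/-- Weyl group elements permute the absolute values of the heights of the roots. -/
theorem sum_abs_height_apply (ha : R.IsSimpleSystem a) {g : V ≃ₗᵢ[ℝ] V}
    (hg : g ∈ R.weylGroup) :
    ∑ α ∈ R.positiveRoots a, |ha.height (g α)| = 2 * ha.height (R.rho a) := by
  classical
  -- `g` permutes `Φ` but not `P`; for even functions the sum over `Φ` is twice the sum over `P`.
  have hsplit : ∀ f : V → ℝ, (∀ x, f (-x) = f x) →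
      ∑ α ∈ R.roots, f α = 2 * ∑ α ∈ R.positiveRoots a, f α := by
    intro f hf
    have hroots : R.roots = R.positiveRoots a ∪ (R.positiveRoots a).image Neg.neg := by
      ext α
      simp only [Finset.mem_union, Finset.mem_image]
      constructor
      · intro h
        rcases ha.mem_or_neg_mem h with h | h
        · exact Or.inl h
        · exact Or.inr ⟨-α, h, neg_neg α⟩
      · rintro (h | ⟨β, h, rfl⟩)
        · exact ha.positiveRoots_subset h
        · exact R.neg_mem _ (ha.positiveRoots_subset h)
    have hdisj : Disjoint (R.positiveRoots a) ((R.positiveRoots a).image Neg.neg) := by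
      rw [Finset.disjoint_left]
      rintro α hα hα'
      obtain ⟨β, hβ, rfl⟩ := Finset.mem_image.1 hα'
      exact ha.neg_notMem hβ hα
    rw [hroots, Finset.sum_union hdisj, Finset.sum_image (fun x _ y _ h => neg_injective h)]
    simp only [hf]
    ring
  have h1 := hsplit (fun x => |ha.height (g x)|) (by simp)
  have h2 := hsplit (fun x => |ha.height x|) (by simp)
  have h3 : ∑ α ∈ R.roots, |ha.height (g α)| = ∑ α ∈ R.roots, |ha.height α| := by
    refine Finset.sum_bij' (fun α _ => g α) (fun α _ => g.symm α)
      (fun α hα => R.apply_mem_roots hg hα)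
      (fun α hα => R.apply_mem_roots (inv_mem hg) hα) (fun α _ => g.symm_apply_apply α)
      (fun α _ => g.apply_symm_apply α) (fun _ _ => rfl)
  have h4 : ∑ α ∈ R.positiveRoots a, |ha.height α| = 2 * ha.height (R.rho a) := by
    rw [rho, map_smul, map_sum, smul_eq_mul, ← mul_assoc]
    norm_num
    exact Finset.sum_congr rfl fun α hα =>
      abs_of_nonneg (zero_le_one.trans (ha.one_le_height hα))
  linarith

theorem height_apply_rho (ha : R.IsSimpleSystem a) (g : V ≃ₗᵢ[ℝ] V) :
    2 * ha.height (g (R.rho a)) = ∑ α ∈ R.positiveRoots a, ha.height (g α) := by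
  rw [rho, map_smul, map_smul, map_sum, map_sum, smul_eq_mul, ← mul_assoc]
  norm_num

/-- Triangle inequality: the heights of the `gα`, `α ∈ P`, sum to `2 ht(gρ)`, and their absolute
values to `2 ht(ρ)`. -/
theorem neg_height_rho_le (ha : R.IsSimpleSystem a) {g : V ≃ₗᵢ[ℝ] V}
    (hg : g ∈ R.weylGroup) : -ha.height (R.rho a) ≤ ha.height (g (R.rho a)) := by
  have h1 := ha.sum_abs_height_apply hg
  have h2 := ha.height_apply_rho g
  have h3 := Finset.abs_sum_le_sum_abs (fun α => ha.height (g α)) (R.positiveRoots a)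
  have := (abs_le.1 h3).1
  linarith

theorem height_apply_rho_le (ha : R.IsSimpleSystem a) {g : V ≃ₗᵢ[ℝ] V}
    (hg : g ∈ R.weylGroup) : ha.height (g (R.rho a)) ≤ ha.height (R.rho a) := by
  have h1 := ha.sum_abs_height_apply hg
  have h2 := ha.height_apply_rho g
  have h3 := Finset.abs_sum_le_sum_abs (fun α => ha.height (g α)) (R.positiveRoots a)
  have := (abs_le.1 h3).2
  linarith

/-- Only the identity preserves the height of `ρ`. -/
theorem eq_one_of_height_apply_rho (ha : R.IsSimpleSystem a) {g : V ≃ₗᵢ[ℝ] V}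
    (hg : g ∈ R.weylGroup) (h : ha.height (g (R.rho a)) = ha.height (R.rho a)) : g = 1 := by
  have h1 := ha.sum_abs_height_apply hg
  have h2 := ha.height_apply_rho g
  -- Equality in the triangle inequality forces every `ht(gα)` to be nonnegative, so `g` keeps
  -- simple roots positive.
  have h3 : ∑ α ∈ R.positiveRoots a, ha.height (g α) =
      ∑ α ∈ R.positiveRoots a, |ha.height (g α)| := by linarith
  rw [Finset.sum_eq_sum_iff_of_le fun α _ => le_abs_self _] at h3
  refine ha.eq_one_of_forall_mem hg fun i => ?_
  refine ha.mem_positiveRoots_of_height_nonneg (R.apply_mem_roots hg (ha.mem_roots i)) ?_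
  rw [h3 _ (ha.simple_mem_positiveRoots i)]
  exact abs_nonneg _

end IsSimpleSystem

end IntegralRootSystem


/-! ### Formal alternating sums and the Weyl denominator formula -/

namespace IntegralRootSystem

variable {V : Type*} [NormedAddCommGroup V] [InnerProductSpace ℝ V] (R : IntegralRootSystem V)

/-- The determinant of a Weyl group element, as a complex number. -/
def weylSign (s : R.weylGroup) : ℂ :=
  ((LinearMap.det (s.1.toLinearEquiv : V →ₗ[ℝ] V) : ℝ) : ℂ)

theorem weylSign_one : R.weylSign 1 = 1 := by
  have : ((1 : R.weylGroup).1.toLinearEquiv : V →ₗ[ℝ] V) = LinearMap.id := rfl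
  rw [weylSign, this, LinearMap.det_id, Complex.ofReal_one]

theorem weylSign_mul (s t : R.weylGroup) : R.weylSign (s * t) = R.weylSign s * R.weylSign t := by
  have : ((s * t).1.toLinearEquiv : V →ₗ[ℝ] V) =
    (s.1.toLinearEquiv : V →ₗ[ℝ] V) * (t.1.toLinearEquiv : V →ₗ[ℝ] V) := rfl
  rw [weylSign, this, map_mul, Complex.ofReal_mul]
  rfl

theorem weylSign_reflection [FiniteDimensional ℝ V] {α : V} (hα : α ∈ R.roots) :
    R.weylSign ⟨rootReflection α, R.rootReflection_mem_weylGroup hα⟩ = -1 := by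
  rw [weylSign, det_rootReflection (R.ne_zero_of_mem hα)]
  simp

theorem norm_weylSign [FiniteDimensional ℝ V] (s : R.weylGroup) : ‖R.weylSign s‖ = 1 := by
  obtain ⟨s, hs⟩ := s
  induction hs using Subgroup.closure_induction with
  | mem x hx =>
    obtain ⟨α, hα, rfl⟩ := hx
    have := R.weylSign_reflection hα
    exact (congrArg norm this).trans (by simp)
  | one => exact (congrArg norm R.weylSign_one).trans (by simp)
  | mul x y hx hy hx' hy' =>
    have := R.weylSign_mul ⟨x, hx⟩ ⟨y, hy⟩
    exact (congrArg norm this).trans (by rw [norm_mul, hx', hy', one_mul])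
  | inv x hx hx' =>
    have h := R.weylSign_mul ⟨x, hx⟩ (⟨x, hx⟩)⁻¹
    rw [mul_inv_cancel, weylSign_one] at h
    have h' := congrArg norm h
    rw [norm_mul, hx', one_mul, norm_one] at h'
    exact h'.symm

open AddMonoidAlgebra

/-- The alternating sum `∑ det(s) e^{sν}` in the group algebra. -/
def formalAlternatingSum (ν : V) : AddMonoidAlgebra ℂ V :=
  ∑ s : R.weylGroup, single (s.1 ν) (R.weylSign s)

theorem expEval_formalAlternatingSum (φ : V →+ ℂ) (ν : V) :
    expEval φ (R.formalAlternatingSum ν) =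
      ∑ s : R.weylGroup, R.weylSign s * Complex.exp (φ (s.1 ν)) := by
  simp [formalAlternatingSum, expEval_single]

variable {R} {r : ℕ} {a : Fin r → V}

namespace IsSimpleSystem

/-- Left multiplication by `s_α` reverses the sign, while `s_α(sν)` and `sν` differ by a multiple of
`α`, integral since `sν` is a weight. -/
theorem modZMultiples_formalAlternatingSum [FiniteDimensional ℝ V] (ha : R.IsSimpleSystem a)
    {ν : V} (hν : ν ∈ weightLattice a) {α : V} (hα : α ∈ R.roots) :
    modZMultiples α (R.formalAlternatingSum ν) = 0 := by
  set σ : R.weylGroup := ⟨rootReflection α, R.rootReflection_mem_weylGroup hα⟩ with hσ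
  set f : R.weylGroup → AddMonoidAlgebra ℂ (V ⧸ AddSubgroup.zmultiples α) :=
    fun s => single ((s.1 ν : V) : V ⧸ AddSubgroup.zmultiples α) (R.weylSign s) with hf
  have hsum : modZMultiples α (R.formalAlternatingSum ν) = ∑ s, f s := by
    simp [formalAlternatingSum, modZMultiples_single, hf]
  have hneg : ∀ s, f (σ * s) = -f s := by
    intro s
    have hq : (((σ * s).1 ν : V) : V ⧸ AddSubgroup.zmultiples α) = (s.1 ν : V) := by
      change ((rootReflection α (s.1 ν) : V) : V ⧸ AddSubgroup.zmultiples α) = _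
      obtain ⟨m, hm⟩ := ha.exists_int_of_mem_weightLattice
        (ha.apply_mem_weightLattice s.2 hν) hα
      rw [rootReflection_apply, hm, Int.cast_smul_eq_zsmul, QuotientAddGroup.eq]
      exact AddSubgroup.mem_zmultiples_iff.2 ⟨m, by abel⟩
    change single _ _ = -single _ _
    rw [hq, R.weylSign_mul, hσ, R.weylSign_reflection hα, neg_one_mul, single_neg]
  have h1 : ∑ s, f s = -∑ s, f s := by
    conv_lhs => rw [← Equiv.sum_comp (Equiv.mulLeft σ) f]
    simp [hneg]
  have h2 : (2 : ℂ) • ∑ s, f s = 0 := by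
    rw [two_smul]
    nth_rw 1 [h1]
    simp
  rw [hsum]
  exact (smul_eq_zero.1 h2).resolve_left two_ne_zero

theorem prod_dvd_formalAlternatingSum [FiniteDimensional ℝ V] (ha : R.IsSimpleSystem a)
    {ν : V} (hν : ν ∈ weightLattice a) :
    (∏ α ∈ R.positiveRoots a, (single α 1 - 1)) ∣ R.formalAlternatingSum ν :=
  prod_single_sub_one_dvd _
    (fun _ hα _ hβ hne m n h => ha.eq_zero_of_zsmul_eq_zsmul hα hβ hne m n h)
    fun _ hα => ha.modZMultiples_formalAlternatingSum hν (ha.positiveRoots_subset hα)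

/-- The Weyl denominator formula in the group algebra. -/
theorem formalAlternatingSum_rho [FiniteDimensional ℝ V] (ha : R.IsSimpleSystem a) :
    R.formalAlternatingSum (R.rho a) =
      (∏ α ∈ R.positiveRoots a, (single α 1 - 1)) * single (-R.rho a) 1 := by
  classical
  obtain ⟨Q, hQ⟩ := ha.prod_dvd_formalAlternatingSum ha.rho_mem_weightLattice
  have hcoeff : ∀ y, (R.formalAlternatingSum (R.rho a)).coeff y =
      ∑ s : R.weylGroup, if s.1 (R.rho a) = y then R.weylSign s else 0 := by
    intro y
    simp [formalAlternatingSum, Finsupp.single_apply]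
  have h2ρ : ∑ α ∈ R.positiveRoots a, α = R.rho a + R.rho a := by
    rw [rho, ← add_smul]
    norm_num
  have hne : ∀ y, (R.formalAlternatingSum (R.rho a)).coeff y ≠ 0 →
      ∃ s : R.weylGroup, s.1 (R.rho a) = y := by
    intro y hy
    by_contra! hcon
    exact hy (by rw [hcoeff, Finset.sum_eq_zero fun s _ => if_neg (hcon s)])
  obtain ⟨h1, h2⟩ := heights_of_prod_mul ha.height.toAddMonoidHom (R.positiveRoots a)
    (fun α hα => zero_lt_one.trans_le (ha.one_le_height hα)) Q
    (-ha.height (R.rho a)) (ha.height (R.rho a)) (by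
      rw [← hQ]
      intro y hy
      obtain ⟨s, rfl⟩ := hne y hy
      exact ⟨ha.neg_height_rho_le s.2, ha.height_apply_rho_le s.2⟩)
  -- The product over `P` already uses up the whole height range `2 ht(ρ)`, so `Q` lives at the
  -- single height `-ht(ρ)`. Its coefficients are those of the alternating sum shifted by `2ρ`,
  -- where only `s = 1` reaches height `ht(ρ)`.
  have hlow : ha.height (R.rho a) - ha.height (R.rho a + R.rho a) = -ha.height (R.rho a) := by
    rw [map_add]; ring
  rw [h2ρ, ← hQ] at h2
  rw [h2ρ] at h1
  simp only [LinearMap.toAddMonoidHom_coe, hlow] at h1 h2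
  suffices Q = single (-R.rho a) 1 by rw [hQ, this]
  ext y
  rw [coeff_single, Finsupp.single_apply]
  split_ifs with hy
  · subst hy
    rw [h2 _ (map_neg _ _), hcoeff, neg_add_cancel_left,
      Finset.sum_eq_single (1 : R.weylGroup) _ (by simp)]
    · exact (if_pos rfl).trans R.weylSign_one
    · intro s _ hs
      refine if_neg fun h => hs (Subtype.ext ?_)
      exact ha.eq_one_of_height_apply_rho s.2 (by rw [h])
  · by_contra hc
    have hyh := le_antisymm (h1 y hc).2 (h1 y hc).1
    have hc' := hc
    rw [h2 y hyh] at hc'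
    obtain ⟨s, hs⟩ := hne _ hc'
    have h3 : s.1 = 1 := ha.eq_one_of_height_apply_rho s.2 (by rw [hs, map_add, map_add, hyh]; ring)
    rw [h3] at hs
    change R.rho a = _ at hs
    refine hy ?_
    have : y = R.rho a - (R.rho a + R.rho a) := eq_sub_of_add_eq hs.symm
    rw [this]
    abel

end IsSimpleSystem

end IntegralRootSystem


/-! ### Iterated differences -/

section Difference

variable {r : ℕ}

theorem iteratedDifference_const_mul (l : List (Fin r)) (c : ℂ) (f : (Fin r → ℤ) → ℂ) :
    iteratedDifference l (fun n => c * f n) = fun n => c * iteratedDifference l f n := by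
  induction l with
  | nil => rfl
  | cons i l ih =>
    funext n
    simp only [iteratedDifference, ih, fwdDiff]
    ring

/-- An exponential in `n` is an eigenfunction of `D_i` with eigenvalue `w s i - 1`; these
eigenvalues produce the gain `N^{-k}`. -/
theorem iteratedDifference_sum_mul {ι : Type*} [Fintype ι] (l : List (Fin r)) (c : ι → ℂ)
    (E : ι → (Fin r → ℤ) → ℂ) (w : ι → Fin r → ℂ)
    (hE : ∀ s n i, E s (n + Pi.single i 1) = E s n * w s i) :
    iteratedDifference l (fun n => ∑ s, c s * E s n) =
      fun n => ∑ s, c s * E s n * (l.map fun i => w s i - 1).prod := by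
  induction l with
  | nil => simp [iteratedDifference]
  | cons i l ih =>
    funext n
    simp only [iteratedDifference, ih, fwdDiff, hE, List.map_cons, List.prod_cons]
    rw [← Finset.sum_sub_distrib]
    exact Finset.sum_congr rfl fun s _ => by ring

theorem differentiable_iteratedDifference (l : List (Fin r)) (f : ℂ → (Fin r → ℤ) → ℂ)
    (hf : ∀ n, Differentiable ℂ fun z => f z n) (n : Fin r → ℤ) :
    Differentiable ℂ fun z => iteratedDifference l (f z) n := by
  induction l generalizing n with
  | nil => exact hf n
  | cons i l ih => exact (ih _).sub (ih _)

theorem exists_norm_iteratedDifference_le {X : Type*} (l : List (Fin r))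
    (f : X → (Fin r → ℤ) → ℂ) (hf : ∀ n, ∃ M, ∀ x, ‖f x n‖ ≤ M) (n : Fin r → ℤ) :
    ∃ M, ∀ x, ‖iteratedDifference l (f x) n‖ ≤ M := by
  induction l generalizing n with
  | nil => exact hf n
  | cons i l ih =>
    obtain ⟨M₁, h₁⟩ := ih (n + Pi.single i 1)
    obtain ⟨M₂, h₂⟩ := ih n
    exact ⟨M₁ + M₂, fun x => (norm_sub_le _ _).trans (add_le_add (h₁ x) (h₂ x))⟩

end Difference

/-! ### Formal characters and their values -/

namespace IntegralRootSystem

open AddMonoidAlgebra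

variable {V : Type*} [NormedAddCommGroup V] [InnerProductSpace ℝ V]
  {R : IntegralRootSystem V} {r : ℕ} {a : Fin r → V}

namespace IsSimpleSystem

/-- The denominator is the product over `P` times the unit `e^{-ρ}`, so divisibility by the product
suffices. -/
theorem exists_formalCharacter [FiniteDimensional ℝ V] (ha : R.IsSimpleSystem a)
    {ν : V} (hν : ν ∈ weightLattice a) : ∃ Q : AddMonoidAlgebra ℂ V,
      R.formalAlternatingSum ν = R.formalAlternatingSum (R.rho a) * Q := by
  obtain ⟨Q, hQ⟩ := ha.prod_dvd_formalAlternatingSum hν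
  refine ⟨single (R.rho a) 1 * Q, ?_⟩
  have : (single (-R.rho a) 1 * single (R.rho a) 1 : AddMonoidAlgebra ℂ V) = 1 := by
    rw [single_mul_single, neg_add_cancel, mul_one, one_def]
  rw [ha.formalAlternatingSum_rho, hQ, mul_assoc, ← mul_assoc (single _ _), this, one_mul]

/-- The Weyl character as an element of the group algebra. -/
def formalCharacter [FiniteDimensional ℝ V] (ha : R.IsSimpleSystem a)
    {ν : V} (hν : ν ∈ weightLattice a) : AddMonoidAlgebra ℂ V :=
  (ha.exists_formalCharacter hν).choose

theorem formalAlternatingSum_eq [FiniteDimensional ℝ V] (ha : R.IsSimpleSystem a)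
    {ν : V} (hν : ν ∈ weightLattice a) :
    R.formalAlternatingSum ν = R.formalAlternatingSum (R.rho a) * ha.formalCharacter hν :=
  (ha.exists_formalCharacter hν).choose_spec

/-- The phase `ν ↦ i(⟨ν, H⟩ + z ht(ν))`, i.e. `i⟨ν, ·⟩` on the complex line through `H` in the
direction dual to the height. -/
def phase (ha : R.IsSimpleSystem a) (H : V) (z : ℂ) : V →+ ℂ where
  toFun ν := Complex.I * ((⟪ν, H⟫_ℝ : ℝ) + z * (ha.height ν : ℝ))
  map_zero' := by simp
  map_add' x y := by
    rw [inner_add_left, map_add]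
    push_cast
    ring

theorem phase_apply (ha : R.IsSimpleSystem a) (H : V) (z : ℂ) (ν : V) :
    ha.phase H z ν = Complex.I * ((⟪ν, H⟫_ℝ : ℝ) + z * (ha.height ν : ℝ)) := rfl

theorem phase_zero_apply (ha : R.IsSimpleSystem a) (H ν : V) :
    ha.phase H 0 ν = Complex.I * ((⟪ν, H⟫_ℝ : ℝ) : ℂ) := by simp [phase_apply]

theorem alternatingSum_eq_expEval (ha : R.IsSimpleSystem a) (ν H : V) :
    R.alternatingSum ν H = expEval (ha.phase H 0) (R.formalAlternatingSum ν) := by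
  simp only [expEval_formalAlternatingSum, phase_zero_apply]
  rfl

theorem expEval_formalAlternatingSum_rho [FiniteDimensional ℝ V] (ha : R.IsSimpleSystem a)
    (φ : V →+ ℂ) : expEval φ (R.formalAlternatingSum (R.rho a)) =
      (∏ α ∈ R.positiveRoots a, (Complex.exp (φ α) - 1)) * Complex.exp (-φ (R.rho a)) := by
  rw [ha.formalAlternatingSum_rho, map_mul, map_prod]
  simp [expEval_single]

theorem alternatingSum_rho [FiniteDimensional ℝ V] (ha : R.IsSimpleSystem a) (H : V) :
    R.alternatingSum (R.rho a) H = R.denominatorProduct a H := by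
  rw [ha.alternatingSum_eq_expEval, ha.expEval_formalAlternatingSum_rho, denominatorProduct,
    mul_comm]
  simp only [phase_zero_apply]

theorem continuous_expEval (ha : R.IsSimpleSystem a) (G : AddMonoidAlgebra ℂ V) :
    Continuous fun H => expEval (ha.phase H 0) G := by
  induction G using AddMonoidAlgebra.induction_linear with
  | zero => simpa using continuous_const
  | add f g hf hg =>
    simp only [map_add]
    exact hf.add hg
  | single y c =>
    simp only [expEval_single, phase_zero_apply]
    fun_prop

theorem differentiable_expEval (ha : R.IsSimpleSystem a) (H : V) (G : AddMonoidAlgebra ℂ V) :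
    Differentiable ℂ fun z => expEval (ha.phase H z) G := by
  induction G using AddMonoidAlgebra.induction_linear with
  | zero => simp
  | add f g hf hg =>
    simp only [map_add]
    exact hf.add hg
  | single y c =>
    simp only [expEval_single, phase_apply]
    fun_prop

theorem exists_norm_expEval_le (ha : R.IsSimpleSystem a) (G : AddMonoidAlgebra ℂ V) :
    ∃ M, ∀ H, ‖expEval (ha.phase H 0) G‖ ≤ M := by
  induction G using AddMonoidAlgebra.induction_linear with
  | zero => exact ⟨0, by simp⟩
  | add f g hf hg =>
    obtain ⟨M₁, h₁⟩ := hf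
    obtain ⟨M₂, h₂⟩ := hg
    refine ⟨M₁ + M₂, fun H => ?_⟩
    rw [map_add]
    exact (norm_add_le _ _).trans (add_le_add (h₁ H) (h₂ H))
  | single y c =>
    refine ⟨‖c‖, fun H => ?_⟩
    rw [expEval_single, phase_zero_apply, norm_mul, Complex.norm_exp_I_mul_ofReal, mul_one]

/-- The complement of the chamber walls is dense. -/
theorem dense_alternatingSum_rho_ne_zero [FiniteDimensional ℝ V] (ha : R.IsSimpleSystem a) :
    Dense {H | R.alternatingSum (R.rho a) H ≠ 0} := by
  intro H
  set δ : V := (InnerProductSpace.toDual ℝ V).symm (LinearMap.toContinuousLinearMap ha.height)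
  have hδ : ∀ v, ⟪v, δ⟫_ℝ = ha.height v := fun v => by
    rw [real_inner_comm, InnerProductSpace.toDual_symm_apply]
    rfl
  have hcont : Continuous fun t : ℝ => H + t • δ := by fun_prop
  -- The parameters at which the line `H + tδ` meets a wall: countably many, as no positive root has
  -- height 0.
  set T : Set ℝ := ⋃ α ∈ R.positiveRoots a,
    Set.range fun n : ℤ => (2 * Real.pi * n - ⟪α, H⟫_ℝ) / ha.height α
  have hT : T.Countable :=
    Set.Countable.biUnion (R.positiveRoots a).countable_toSet fun _ _ => Set.countable_range _
  have hsub : (fun t : ℝ => H + t • δ) '' Tᶜ ⊆ {H | R.alternatingSum (R.rho a) H ≠ 0} := by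
    rintro _ ⟨t, ht, rfl⟩
    rw [Set.mem_ofPred_eq, ha.alternatingSum_eq_expEval, ha.expEval_formalAlternatingSum_rho]
    refine mul_ne_zero (Finset.prod_ne_zero_iff.2 fun α hα h => ht ?_) (Complex.exp_ne_zero _)
    rw [sub_eq_zero, Complex.exp_eq_one_iff] at h
    obtain ⟨n, hn⟩ := h
    refine Set.mem_biUnion hα ⟨n, ?_⟩
    rw [phase_zero_apply, inner_add_right, inner_smul_right, hδ] at hn
    have h1 : ((⟪α, H⟫_ℝ + t * ha.height α : ℝ) : ℂ) = ((2 * Real.pi * n : ℝ) : ℂ) := by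
      refine mul_left_cancel₀ Complex.I_ne_zero (hn.trans ?_)
      push_cast
      ring
    have h2 := Complex.ofReal_injective h1
    have h3 : ha.height α ≠ 0 := (zero_lt_one.trans_le (ha.one_le_height hα)).ne'
    simp only
    rw [← h2]
    field_simp
    ring
  have hmem : (0 : ℝ) ∈ closure Tᶜ := (hT.dense_compl ℝ) 0
  have := image_closure_subset_closure_image hcont (Set.mem_image_of_mem _ hmem)
  simp only [zero_smul, add_zero] at this
  exact closure_mono hsub this

theorem expEval_formalCharacter [FiniteDimensional ℝ V] (ha : R.IsSimpleSystem a)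
    {ν : V} (hν : ν ∈ weightLattice a) {H : V} (hH : R.alternatingSum (R.rho a) H ≠ 0) :
    expEval (ha.phase H 0) (ha.formalCharacter hν) =
      R.alternatingSum ν H / R.alternatingSum (R.rho a) H := by
  rw [eq_div_iff hH, ha.alternatingSum_eq_expEval, ha.alternatingSum_eq_expEval,
    ha.formalAlternatingSum_eq hν, map_mul, mul_comm]

/-- The continuous extension of the Weyl character is an exponential polynomial. -/
theorem weylCharacter_eq [FiniteDimensional ℝ V] (ha : R.IsSimpleSystem a)
    {ν : V} (hν : ν ∈ weightLattice a) (H : V) :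
    R.weylCharacter a ν H = expEval (ha.phase H 0) (ha.formalCharacter hν) := by
  refine extendFrom_eq (ha.dense_alternatingSum_rho_ne_zero H) ?_
  refine ((ha.continuous_expEval (ha.formalCharacter hν)).tendsto H).mono_left
    nhdsWithin_le_nhds |>.congr' ?_
  filter_upwards [self_mem_nhdsWithin] with H' hH'
  exact ha.expEval_formalCharacter hν hH'

theorem sum_smul_add_mem_weightLattice (ha : R.IsSimpleSystem a) {μ : V}
    (hμ : μ ∈ weightLattice a) (n : Fin r → ℤ) :
    ∑ i, (n i : ℝ) • a i + μ ∈ weightLattice a := by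
  refine add_mem (sum_mem fun i _ => ?_) hμ
  rw [Int.cast_smul_eq_zsmul]
  exact zsmul_mem (ha.simple_mem_weightLattice i) _

/-! ### Estimates on complex lines -/

/-- On the circle `|z| = 2b`, the phase of a root is close to `2πiℤ` if `⟨β, H⟩` is `b`-close to
`2πℤ`. -/
theorem exists_phase_eq (ha : R.IsSimpleSystem a) {H β : V} {b h : ℝ} {z : ℂ} (hb : 0 ≤ b)
    (hz : ‖z‖ = 2 * b) (hβ : |ha.height β| ≤ h) (hh : 1 ≤ h)
    (hH : ∃ m : ℤ, |⟪β, H⟫_ℝ - 2 * Real.pi * m| ≤ b) :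
    ∃ u : ℂ, Complex.exp (ha.phase H z β) = Complex.exp u ∧ ‖u‖ ≤ 3 * b * h ∧
      2 * b * |ha.height β| - b ≤ ‖u‖ := by
  obtain ⟨m, hm⟩ := hH
  have h1 : ‖((⟪β, H⟫_ℝ - 2 * Real.pi * m : ℝ) : ℂ)‖ ≤ b := by
    rwa [Complex.norm_real, Real.norm_eq_abs]
  have h2 : ‖z * (ha.height β : ℝ)‖ = 2 * b * |ha.height β| := by
    rw [norm_mul, hz, Complex.norm_real, Real.norm_eq_abs]
  -- `u` is the phase minus `2πim`: a term of size at most `b` plus one of size `2b |ht β|`. Since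
  -- `h ≥ 1`, `b + 2bh ≤ 3bh`.
  refine ⟨Complex.I * (((⟪β, H⟫_ℝ - 2 * Real.pi * m : ℝ) : ℂ) + z * (ha.height β : ℝ)),
    ?_, ?_, ?_⟩
  · rw [Complex.exp_eq_exp_iff_exists_int]
    refine ⟨m, ?_⟩
    rw [phase_apply]
    push_cast
    ring
  · rw [norm_mul, Complex.norm_I, one_mul]
    refine (norm_add_le _ _).trans ?_
    rw [h2]
    nlinarith
  · rw [norm_mul, Complex.norm_I, one_mul, add_comm]
    have := norm_sub_norm_le (z * (ha.height β : ℝ))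
      (-((⟪β, H⟫_ℝ - 2 * Real.pi * m : ℝ) : ℂ))
    rw [norm_neg, sub_neg_eq_add, h2] at this
    linarith

theorem abs_re_phase_le (ha : R.IsSimpleSystem a) (H ν : V) (z : ℂ) :
    |(ha.phase H z ν).re| ≤ ‖z‖ * |ha.height ν| := by
  have : (ha.phase H z ν).re = -(z.im * ha.height ν) := by
    simp [phase_apply]
  rw [this, abs_neg, abs_mul]
  exact mul_le_mul_of_nonneg_right (Complex.abs_im_le_norm z) (abs_nonneg _)

/-- The difference estimate in terms of the distance `b` of the `⟨β, H⟩` to `2πℤ`. -/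
theorem norm_iteratedDifference_mul_pow_le [FiniteDimensional ℝ V] (ha : R.IsSimpleSystem a)
    {μ : V} (hμ : μ ∈ weightLattice a) {b h T : ℝ} (hb : 0 < b) (hh : 1 ≤ h)
    (hroots : ∀ β ∈ R.roots, |ha.height β| ≤ h) (hbh : 3 * b * h ≤ 1 / 2) {H : V}
    (hH : ∀ β ∈ R.roots, ∃ m : ℤ, |⟪β, H⟫_ℝ - 2 * Real.pi * m| ≤ b)
    (hρ : b * |ha.height (R.rho a)| ≤ T) (n : Fin r → ℤ)
    (hn : ∀ s : R.weylGroup, b * |ha.height (s.1 (∑ i, (n i : ℝ) • a i + μ))| ≤ T)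
    (l : List (Fin r)) :
    ‖iteratedDifference l
        (fun m => R.weylCharacter a (∑ i, (m i : ℝ) • a i + μ) H) n‖ ≤
      Fintype.card R.weylGroup * Real.exp (2 * T) * (6 * b * h) ^ l.length /
        ((b / 2) ^ (R.positiveRoots a).card * Real.exp (-(2 * T))) := by
  set χ : (Fin r → ℤ) → AddMonoidAlgebra ℂ V := fun m =>
    ha.formalCharacter (ha.sum_smul_add_mem_weightLattice hμ m) with hχ
  set g : ℂ → ℂ := fun z => iteratedDifference l (fun m => expEval (ha.phase H z) (χ m)) n with hg
  have hg0 : iteratedDifference l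
      (fun m => R.weylCharacter a (∑ i, (m i : ℝ) • a i + μ) H) n = g 0 := by
    simp only [hg, hχ, ← ha.weylCharacter_eq]
  have hgd : Differentiable ℂ g :=
    differentiable_iteratedDifference l _ (fun m => ha.differentiable_expEval H (χ m)) n
  -- The denominator is constant in `n`, so it passes through the differences and clears the
  -- quotient.
  have hmul : ∀ z, expEval (ha.phase H z) (R.formalAlternatingSum (R.rho a)) * g z =
      ∑ s : R.weylGroup, R.weylSign s *
        Complex.exp (ha.phase H z (s.1 (∑ i, (n i : ℝ) • a i + μ))) *
          (l.map fun i => Complex.exp (ha.phase H z (s.1 (a i))) - 1).prod := by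
    intro z
    have h1 := congrFun (iteratedDifference_const_mul l
      (expEval (ha.phase H z) (R.formalAlternatingSum (R.rho a)))
      (fun m => expEval (ha.phase H z) (χ m))) n
    have h2 : (fun m => expEval (ha.phase H z) (R.formalAlternatingSum (R.rho a)) *
        expEval (ha.phase H z) (χ m)) = fun m : Fin r → ℤ => ∑ s : R.weylGroup, R.weylSign s *
          Complex.exp (ha.phase H z (s.1 (∑ i, (m i : ℝ) • a i + μ))) := by
      funext m
      rw [← map_mul, ← ha.formalAlternatingSum_eq, expEval_formalAlternatingSum]
    rw [← h1, h2]
    refine congrFun (iteratedDifference_sum_mul l R.weylSign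
      (fun s m => Complex.exp (ha.phase H z (s.1 (∑ i, (m i : ℝ) • a i + μ))))
      (fun s i => Complex.exp (ha.phase H z (s.1 (a i)))) fun s m i => ?_) n
    rw [← Complex.exp_add, ← map_add, ← map_add]
    congr 3
    simp only [Pi.add_apply, Pi.single_apply, Int.cast_add, add_smul, Finset.sum_add_distrib]
    simp
    abel
  have hexp : ∀ z : ℂ, ‖z‖ = 2 * b → ∀ ν, b * |ha.height ν| ≤ T →
      |(ha.phase H z ν).re| ≤ 2 * T := by
    intro z hz ν hν
    have := ha.abs_re_phase_le H ν z
    rw [hz] at this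
    linarith
  have hnum : ∀ z : ℂ, ‖z‖ = 2 * b →
      ‖expEval (ha.phase H z) (R.formalAlternatingSum (R.rho a)) * g z‖ ≤
        Fintype.card R.weylGroup * Real.exp (2 * T) * (6 * b * h) ^ l.length := by
    intro z hz
    rw [hmul]
    refine (norm_sum_le _ _).trans ?_
    have hterm : ∀ s ∈ (Finset.univ : Finset R.weylGroup), ‖R.weylSign s *
        Complex.exp (ha.phase H z (s.1 (∑ i, (n i : ℝ) • a i + μ))) *
          (l.map fun i => Complex.exp (ha.phase H z (s.1 (a i))) - 1).prod‖ ≤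
        Real.exp (2 * T) * (6 * b * h) ^ l.length := by
      intro s _
      rw [norm_mul, norm_mul, R.norm_weylSign, one_mul, Complex.norm_exp]
      refine mul_le_mul (Real.exp_le_exp.2 ((le_abs_self _).trans (hexp z hz _ (hn s))))
        ?_ (norm_nonneg _) (Real.exp_pos _).le
      clear hg hg0 hgd hmul
      induction l with
      | nil => simp
      | cons i l ih =>
        rw [List.map_cons, List.prod_cons, norm_mul, List.length_cons, pow_succ']
        refine mul_le_mul ?_ ih (norm_nonneg _) (by positivity)
        have hmem := R.apply_mem_roots s.2 (ha.mem_roots i)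
        obtain ⟨u, hu, hu1, -⟩ := ha.exists_phase_eq hb.le hz (hroots _ hmem) hh (hH _ hmem)
        rw [hu]
        -- `|e^u - 1| ≤ 2|u| ≤ 6bh`.
        refine (Complex.norm_exp_sub_one_le (by linarith)).trans ?_
        linarith
    refine (Finset.sum_le_sum hterm).trans ?_
    rw [Finset.sum_const, nsmul_eq_mul, Finset.card_univ, ← mul_assoc]
  have hden : ∀ z : ℂ, ‖z‖ = 2 * b →
      (b / 2) ^ (R.positiveRoots a).card * Real.exp (-(2 * T)) ≤
        ‖expEval (ha.phase H z) (R.formalAlternatingSum (R.rho a))‖ := by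
    intro z hz
    rw [ha.expEval_formalAlternatingSum_rho, norm_mul, norm_prod, ← Finset.prod_const]
    refine mul_le_mul (Finset.prod_le_prod (fun _ _ => by positivity) fun α hα => ?_) ?_
      (Real.exp_pos _).le (Finset.prod_nonneg fun _ _ => norm_nonneg _)
    · have hmem := ha.positiveRoots_subset hα
      obtain ⟨u, hu, hu1, hu2⟩ := ha.exists_phase_eq hb.le hz (hroots _ hmem) hh (hH _ hmem)
      have h1 := ha.one_le_height hα
      rw [abs_of_nonneg (zero_le_one.trans h1)] at hu2
      -- Height at least 1 gives `2b ht(α) - b ≥ b`; this is why the radius is `2b`.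
      have hbu : b ≤ ‖u‖ := by nlinarith
      rw [hu]
      -- As `|u| ≤ 1/2`, `|e^u - 1| ≥ |u| - |u|² ≥ |u|/2 ≥ b/2`.
      have h3 := Complex.norm_exp_sub_one_sub_id_le (x := u) (by linarith)
      have h4 := norm_sub_norm_le u (-(Complex.exp u - 1 - u))
      rw [norm_neg, sub_neg_eq_add, add_sub_cancel] at h4
      nlinarith
    · rw [Complex.norm_exp]
      refine Real.exp_le_exp.2 ?_
      have := (abs_le.1 (hexp z hz _ hρ)).2
      rw [Complex.neg_re]
      linarith
  rw [hg0]
  -- The maximum principle bounds `g 0` although the denominator may vanish there.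
  refine Complex.norm_le_of_forall_mem_frontier_norm_le (U := Metric.ball (0 : ℂ) (2 * b))
    Metric.isBounded_ball hgd.diffContOnCl (fun z hz => ?_)
    (subset_closure (Metric.mem_ball_self (by positivity)))
  rw [frontier_ball _ (by positivity), mem_sphere_zero_iff_norm] at hz
  rw [le_div_iff₀ (by positivity)]
  refine le_trans ?_ (hnum z hz)
  rw [norm_mul, mul_comm]
  exact mul_le_mul_of_nonneg_right (hden z hz) (norm_nonneg _)

end IsSimpleSystem

end IntegralRootSystem


/-! ### Uniform constants and the final estimate. -/

namespace IntegralRootSystem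

variable {V : Type*} [NormedAddCommGroup V] [InnerProductSpace ℝ V]
  {R : IntegralRootSystem V} {r : ℕ} {a : Fin r → V}

namespace IsSimpleSystem

/-- The heights of the weights `s(∑ nᵢ aᵢ + μ)` grow at most linearly in `n`. -/
theorem exists_abs_height_le (ha : R.IsSimpleSystem a) (μ : V) {A : ℝ} (hA : 0 < A) :
    ∃ K, 0 ≤ K ∧ |ha.height (R.rho a)| ≤ K ∧ ∀ N : ℝ, 1 ≤ N → ∀ n : Fin r → ℤ,
      (∀ i, |(n i : ℝ)| ≤ A * N) → ∀ s : R.weylGroup,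
        |ha.height (s.1 (∑ i, (n i : ℝ) • a i + μ))| ≤ K * N := by
  set K : ℝ := |ha.height (R.rho a)| +
    ∑ s : R.weylGroup, (∑ i, A * |ha.height (s.1 (a i))| + |ha.height (s.1 μ)|)
  have hterm : ∀ s : R.weylGroup,
      0 ≤ ∑ i, A * |ha.height (s.1 (a i))| + |ha.height (s.1 μ)| := fun s => by positivity
  have hsum := Finset.sum_nonneg fun s (_ : s ∈ Finset.univ) => hterm s
  refine ⟨K, add_nonneg (abs_nonneg _) hsum, le_add_of_nonneg_right hsum, ?_⟩
  intro N hN n hn s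
  have h1 : ∑ i, A * |ha.height (s.1 (a i))| + |ha.height (s.1 μ)| ≤ K :=
    (Finset.single_le_sum (fun s _ => hterm s) (Finset.mem_univ s)).trans
      (le_add_of_nonneg_left (abs_nonneg _))
  refine le_trans ?_ (mul_le_mul_of_nonneg_right h1 (by linarith))
  rw [map_add, map_add, map_sum, map_sum, add_mul, Finset.sum_mul]
  refine (abs_add_le _ _).trans (add_le_add ?_ (le_mul_of_one_le_right (abs_nonneg _) hN))
  refine (Finset.abs_sum_le_sum_abs _ _).trans (Finset.sum_le_sum fun i _ => ?_)
  rw [map_smul, map_smul, smul_eq_mul, abs_mul, mul_right_comm]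
  exact mul_le_mul_of_nonneg_right (hn i) (abs_nonneg _)

/-- For bounded `n` and differences of fixed order, the differences are bounded uniformly in `H`. -/
theorem exists_norm_iteratedDifference_le_of_bounded [FiniteDimensional ℝ V]
    (ha : R.IsSimpleSystem a) {μ : V} (hμ : μ ∈ weightLattice a) (L : ℝ) (k : ℕ) :
    ∃ M : ℝ, ∀ n : Fin r → ℤ, (∀ i, |(n i : ℝ)| ≤ L) → ∀ l : List (Fin r), l.length = k →
      ∀ H, ‖iteratedDifference l
        (fun m => R.weylCharacter a (∑ i, (m i : ℝ) • a i + μ) H) n‖ ≤ M := by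
  have hfin : ({n : Fin r → ℤ | ∀ i, |(n i : ℝ)| ≤ L} ×ˢ
      {l : List (Fin r) | l.length = k}).Finite := by
    refine Set.Finite.prod ?_ (List.finite_length_eq _ _)
    refine (Set.finite_Icc (fun _ => -⌈L⌉ : Fin r → ℤ) fun _ => ⌈L⌉).subset fun n hn => ?_
    have h : ∀ i, -⌈L⌉ ≤ n i ∧ n i ≤ ⌈L⌉ := fun i => by
      obtain ⟨h1, h2⟩ := abs_le.1 (hn i)
      have h3 := Int.le_ceil L
      constructor
      · have : -(⌈L⌉ : ℝ) ≤ n i := by linarith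
        exact_mod_cast this
      · have : (n i : ℝ) ≤ ⌈L⌉ := by linarith
        exact_mod_cast this
    exact ⟨fun i => (h i).1, fun i => (h i).2⟩
  have hex := fun p : (Fin r → ℤ) × List (Fin r) =>
    exists_norm_iteratedDifference_le p.2
      (fun (H : V) (m : Fin r → ℤ) => R.weylCharacter a (∑ i, (m i : ℝ) • a i + μ) H)
      (fun m => by
        simp only [ha.weylCharacter_eq (ha.sum_smul_add_mem_weightLattice hμ m)]
        exact ha.exists_norm_expEval_le _) p.1
  choose M hM using hex
  obtain ⟨M', hM'⟩ := (hfin.image M).bddAbove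
  exact ⟨M', fun n hn l hl H => (hM (n, l) H).trans (hM' ⟨(n, l), ⟨hn, hl⟩, rfl⟩)⟩

/-- The hypothesis on `H` in terms of distances to `2πℤ`. -/
theorem exists_abs_inner_sub_le (ha : R.IsSimpleSystem a) {H : V} {b : ℝ}
    (hH : ∀ α ∈ R.positiveRoots a,
      ‖((1 / (2 * Real.pi) * ⟪α, H⟫_ℝ : ℝ) : UnitAddCircle)‖ ≤ b) :
    ∀ β ∈ R.roots, ∃ m : ℤ, |⟪β, H⟫_ℝ - 2 * Real.pi * m| ≤ 2 * Real.pi * b := by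
  have key : ∀ α ∈ R.positiveRoots a,
      ∃ m : ℤ, |⟪α, H⟫_ℝ - 2 * Real.pi * m| ≤ 2 * Real.pi * b := by
    intro α hα
    have h := hH α hα
    rw [UnitAddCircle.norm_eq] at h
    refine ⟨round (1 / (2 * Real.pi) * ⟪α, H⟫_ℝ), ?_⟩
    have hpi : (0 : ℝ) < 2 * Real.pi := by positivity
    have : ⟪α, H⟫_ℝ - 2 * Real.pi * round (1 / (2 * Real.pi) * ⟪α, H⟫_ℝ) = 2 * Real.pi *
        (1 / (2 * Real.pi) * ⟪α, H⟫_ℝ - round (1 / (2 * Real.pi) * ⟪α, H⟫_ℝ)) := by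
      field_simp
    rw [this, abs_mul, abs_of_pos hpi]
    exact mul_le_mul_of_nonneg_left h hpi.le
  intro β hβ
  rcases ha.mem_or_neg_mem hβ with h | h
  · exact key β h
  · obtain ⟨m, hm⟩ := key _ h
    refine ⟨-m, ?_⟩
    rw [← abs_neg] at hm
    convert hm using 2
    rw [inner_neg_left]
    push_cast
    ring

end IsSimpleSystem

end IntegralRootSystem

end

theorem mainTheorem6 {V : Type*} [NormedAddCommGroup V] [InnerProductSpace ℝ V]
    [FiniteDimensional ℝ V] (R : IntegralRootSystem V) {r : ℕ} (a : Fin r → V)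
    (ha : R.IsSimpleSystem a) (μ : V) (hμ : μ ∈ weightLattice a) :
    -- the two forms of the Weyl denominator agree
    (∀ H : V, R.alternatingSum (R.rho a) H = R.denominatorProduct a H) ∧
    -- the characters are well defined: continuous, and equal to the quotient off the walls
    (∀ n : Fin r → ℤ,
      Continuous (R.weylCharacter a (∑ i, (n i : ℝ) • a i + μ)) ∧
      ∀ H : V, R.alternatingSum (R.rho a) H ≠ 0 →
        R.weylCharacter a (∑ i, (n i : ℝ) • a i + μ) H =
          R.alternatingSum (∑ i, (n i : ℝ) • a i + μ) H / R.alternatingSum (R.rho a) H) ∧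
    -- the difference estimates
    (∀ A B : ℝ, 0 < A → 0 < B → ∀ k : ℕ, ∃ C : ℝ, 0 < C ∧
      ∀ N : ℝ, 1 ≤ N → ∀ H : V,
        (∀ α ∈ R.positiveRoots a,
          ‖((1 / (2 * Real.pi) * ⟪α, H⟫_ℝ : ℝ) : UnitAddCircle)‖ ≤ B * N⁻¹) →
        ∀ n : Fin r → ℤ, (∀ i, |(n i : ℝ)| ≤ A * N) →
          ∀ l : List (Fin r), l.length = k →
            ‖iteratedDifference l
                (fun m => R.weylCharacter a (∑ i, (m i : ℝ) • a i + μ) H) n‖ ≤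
              C * N ^ (((R.positiveRoots a).card : ℤ) - (k : ℤ))) := by
  refine ⟨ha.alternatingSum_rho, fun n => ⟨?_, fun H hH => ?_⟩, fun A B hA hB k => ?_⟩
  · have hν := ha.sum_smul_add_mem_weightLattice hμ n
    rw [funext (ha.weylCharacter_eq hν)]
    exact ha.continuous_expEval _
  · have hν := ha.sum_smul_add_mem_weightLattice hμ n
    rw [ha.weylCharacter_eq hν, ha.expEval_formalCharacter hν hH]
  set p := (R.positiveRoots a).card with hp
  obtain ⟨K, hK0, hKρ, hK⟩ := ha.exists_abs_height_le μ hA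
  set h : ℝ := 1 + ∑ β ∈ R.roots, |ha.height β| with hhdef
  have hh : 1 ≤ h := le_add_of_nonneg_right (Finset.sum_nonneg fun _ _ => abs_nonneg _)
  have hroots : ∀ β ∈ R.roots, |ha.height β| ≤ h := fun β hβ =>
    (Finset.single_le_sum (f := fun β => |ha.height β|) (fun _ _ => abs_nonneg _) hβ).trans
      (le_add_of_nonneg_left zero_le_one)
  -- Each `⟨β, H⟩` lies within `b = c N⁻¹` of `2πℤ`.
  set c : ℝ := 2 * Real.pi * B with hc
  have hc0 : 0 < c := by positivity
  -- The threshold: `N ≥ N₀` is exactly `3bh ≤ 1/2`.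
  set N₀ : ℝ := 6 * c * h with hN₀
  have hN₀0 : 0 < N₀ := by positivity
  obtain ⟨M, hM⟩ := ha.exists_norm_iteratedDifference_le_of_bounded hμ (A * N₀) k
  -- The circle bound with `b = c N⁻¹` and `T = cK`, stripped of its factor `N^{p-k}`.
  set C₁ : ℝ := Fintype.card R.weylGroup * Real.exp (2 * (c * K)) * (6 * c * h) ^ k /
    ((c / 2) ^ p * Real.exp (-(2 * (c * K)))) with hC₁
  have hC₁0 : 0 ≤ C₁ := by positivity
  -- For `1 ≤ N ≤ N₀` the crude bound `M` suffices, since `N^{p-k} ≥ N^{-k} ≥ N₀^{-k}`.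
  set C₂ : ℝ := |M| * N₀ ^ k with hC₂
  have hC₂0 : 0 ≤ C₂ := by positivity
  refine ⟨C₁ + C₂ + 1, by positivity, ?_⟩
  intro N hN H hH n hn l hl
  have hN0 : 0 < N := by linarith
  have hpow : 0 < N ^ ((p : ℤ) - (k : ℤ)) := zpow_pos hN0 _
  rcases le_total N₀ N with hNN | hNN
  · have hmain := ha.norm_iteratedDifference_mul_pow_le hμ (b := c * N⁻¹) (h := h) (T := c * K)
      (by positivity) hh hroots ?_ (H := H) ?_ ?_ n ?_ l
    · refine hmain.trans ?_
      rw [hl]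
      have heq : Fintype.card R.weylGroup * Real.exp (2 * (c * K)) * (6 * (c * N⁻¹) * h) ^ k /
          ((c * N⁻¹ / 2) ^ p * Real.exp (-(2 * (c * K)))) =
          C₁ * N ^ ((p : ℤ) - (k : ℤ)) := by
        rw [hC₁, zpow_sub₀ hN0.ne', zpow_natCast, zpow_natCast,
          show 6 * (c * N⁻¹) * h = (6 * c * h) * N⁻¹ by ring,
          show c * N⁻¹ / 2 = (c / 2) * N⁻¹ by ring, mul_pow, mul_pow (c / 2), inv_pow, inv_pow]
        have := hN0.ne'
        have := (Real.exp_pos (-(2 * (c * K)))).ne'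
        field_simp
      rw [heq]
      exact mul_le_mul_of_nonneg_right (by linarith) hpow.le
    · have : 6 * (c * N⁻¹) * h ≤ 1 := by
        rw [show 6 * (c * N⁻¹) * h = N₀ * N⁻¹ by rw [hN₀]; ring, ← div_eq_mul_inv]
        exact (div_le_one hN0).2 hNN
      linarith
    · have := ha.exists_abs_inner_sub_le hH
      simpa [hc, mul_assoc] using this
    · have h1 : N⁻¹ ≤ 1 := inv_le_one_of_one_le₀ hN
      calc c * N⁻¹ * |ha.height (R.rho a)| ≤ c * 1 * K := by gcongr
        _ = c * K := by ring
    · intro s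
      calc c * N⁻¹ * |ha.height (s.1 (∑ i, (n i : ℝ) • a i + μ))| ≤ c * N⁻¹ * (K * N) := by
            gcongr
            exact hK N hN n hn s
        _ = c * K := by field_simp
  · have h1 := hM n (fun i => (hn i).trans (by gcongr)) l hl H
    have h2 : (N₀ ^ k)⁻¹ ≤ N ^ ((p : ℤ) - (k : ℤ)) := by
      calc (N₀ ^ k)⁻¹ ≤ (N ^ k)⁻¹ := by gcongr
        _ = N ^ (-(k : ℤ)) := by rw [zpow_neg, zpow_natCast]
        _ ≤ _ := zpow_le_zpow_right₀ hN (by omega)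
    calc _ ≤ M := h1
      _ ≤ |M| := le_abs_self M
      _ = C₂ * (N₀ ^ k)⁻¹ := by rw [hC₂, mul_inv_cancel_right₀ (pow_pos hN₀0 k).ne']
      _ ≤ C₂ * N ^ ((p : ℤ) - (k : ℤ)) := by gcongr
      _ ≤ _ := mul_le_mul_of_nonneg_right (by linarith) hpow.le
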